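/- Let $M$ be a (Hausdorff, finite-dimensional) complex manifold with a Kähler metric $g_M$, and let $\pi:(L,h)\to M$ be a holomorphic line bundle with a smooth Hermitian metric $h$ such that the Kähler form of $g_M$ is $\omega_M=-\sqrt{-1}\,\partial\bar\partial\log h$, where in this formula $h$ also denotes the function $|e|_h^2$ for any local nowhere vanishing holomorphic section $e$ of $L$. Let $L^*$ be the dual bundle with the dual metric $h^{-1}$, let $$D(L^*)=\{v\in L^*:\ |v|_{h^{-1}}<1\}$$ be the disc bundle, with projection again denoted $\pi:D(L^*)\to M$, and put $$\omega_D=\pi^*\omega_M-\sqrt{-1}\,\partial\bar\partial\log\bigl(1-|v|^2_{h^{-1}}\bigr)\quad\text{on } D(L^*).$$ If the Riemannian metric $g_M$ is complete, then $\omega_D$ is the fundamental form of a smooth Hermitian metric $g_D$ on $D(L^*)$, i.e. $\omega_D(u,v)=g_D(Ju,v)$ with $J$ the complex structure, and $g_D$ is complete. Here a metric is complete if every Cauchy sequence for its distance function (the infimum of the lengths of $C^1$ paths, equal to $+\infty$ between different connected components) converges. -/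

import Mathlib

open scoped Manifold ContDiff Topology Bundle

noncomputable section

namespace DiscBundle

section ComplexManifold

/-! Generalities: `X` is a manifold modelled on a complex normed space `V`, regarded as a real
manifold through a real model with corners `I`. The tangent space `T_x X` is the model space `V`,
through the preferred chart at `x`; this is also how multiplication by `i` acts on it. -/

variable {V : Type*} [NormedAddCommGroup V] [NormedSpace ℂ V]
variable {H : Type*} [TopologicalSpace H] (I : ModelWithCorners ℝ V H)
variable {X : Type*} [TopologicalSpace X] [ChartedSpace H X]

/-- The complex structure `J` of `T_x X`: multiplication by `i`. -/
def J (x : X) (u : TangentSpace I x) : TangentSpace I x :=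
  letI w : V := u
  Complex.I • w

/-- The real Hessian at `x` of `f : X → ℝ` in the preferred chart at `x`. -/
def chartHessian (f : X → ℝ) (x : X) (u v : V) : ℝ :=
  fderiv ℝ (fderiv ℝ (f ∘ (extChartAt I x).symm)) (extChartAt I x x) u v

/-- The value at `x` of the real `(1,1)`-form `√-1 ∂∂̄ f`. In holomorphic coordinates
`√-1 ∂∂̄ f = √-1 ∑ f_{j k̄} dz_j ∧ dz̄_k`, whose value on `(u, v)` is
`-2 Im ∑ f_{j k̄} u_j v̄_k = (D²f(iu, v) - D²f(u, iv)) / 2`. -/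
def iddbar (f : X → ℝ) (x : X) (u v : TangentSpace I x) : ℝ :=
  (chartHessian I f x (J I x u) v - chartHessian I f x u (J I x v)) / 2

variable [IsManifold I ∞ X]

/-- The smooth Riemannian metric `g` is Hermitian (`J` is an isometry of each tangent space) and
`Ω` is its fundamental form, `Ω(u, v) = g(J u, v)`; equivalently `g(u, v) = Ω(u, J v)`. -/
def IsHermitianWithForm
    (g : Bundle.ContMDiffRiemannianMetric I ∞ V (fun x : X ↦ TangentSpace I x))
    (Ω : ∀ x : X, TangentSpace I x → TangentSpace I x → ℝ) : Prop :=
  ∀ (x : X) (u v : TangentSpace I x),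
    g.inner x (J I x u) (J I x v) = g.inner x u v ∧ Ω x u v = g.inner x (J I x u) v

/-- The (extended) distance of a Riemannian metric: the infimum of the lengths of `C^1` paths. -/
def metricDist (g : Bundle.ContMDiffRiemannianMetric I ∞ V (fun x : X ↦ TangentSpace I x))
    (x y : X) : ENNReal :=
  letI : Bundle.RiemannianBundle (fun x : X ↦ TangentSpace I x) := ⟨g.toRiemannianMetric⟩
  Manifold.riemannianEDist I x y

/-- A Riemannian metric is complete if every Cauchy sequence for its distance converges. -/
def IsCompleteMetric
    (g : Bundle.ContMDiffRiemannianMetric I ∞ V (fun x : X ↦ TangentSpace I x)) : Prop :=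
  ∀ a : ℕ → X,
    (∀ ε : ENNReal, 0 < ε → ∃ N, ∀ j ≥ N, ∀ k ≥ N, metricDist I g (a j) (a k) < ε) →
    ∃ x : X, Filter.Tendsto (fun j ↦ metricDist I g (a j) x) Filter.atTop (𝓝 0)

end ComplexManifold

section RealStructure

variable {E F : Type*} [NormedAddCommGroup E] [NormedSpace ℂ E]
  [NormedAddCommGroup F] [NormedSpace ℂ F]

/-- A complex manifold is a smooth real manifold. -/
instance isManifold_real {M : Type*} [TopologicalSpace M] [ChartedSpace E M]
    [IsManifold 𝓘(ℂ, E) ω M] : IsManifold 𝓘(ℝ, E) ∞ M := by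
  refine isManifold_of_contDiffOn _ _ _ fun e e' he he' ↦ ?_
  have h := ((mem_groupoid_of_pregroupoid.1
    (HasGroupoid.compatible (G := contDiffGroupoid ω 𝓘(ℂ, E)) he he')).1)
  exact (ContDiffOn.restrict_scalars ℝ h).of_le (by exact le_top)

/-- The same for a complex manifold modelled on a product (such as the total space of a bundle). -/
instance isManifold_real_prod {X : Type*} [TopologicalSpace X] [ChartedSpace (ModelProd E F) X]
    [IsManifold (𝓘(ℂ, E).prod 𝓘(ℂ, F)) ω X] :
    IsManifold (𝓘(ℝ, E).prod 𝓘(ℝ, F)) ∞ X := by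
  refine isManifold_of_contDiffOn _ _ _ fun e e' he he' ↦ ?_
  have h := ((mem_groupoid_of_pregroupoid.1
    (HasGroupoid.compatible (G := contDiffGroupoid ω (𝓘(ℂ, E).prod 𝓘(ℂ, F))) he he')).1)
  exact (ContDiffOn.restrict_scalars ℝ h).of_le (by exact le_top)

end RealStructure

section LineBundle

variable (E : Type*) [NormedAddCommGroup E] [NormedSpace ℂ E]
variable {M : Type*} [TopologicalSpace M] [ChartedSpace E M]
variable (L : M → Type*) [∀ x, AddCommGroup (L x)] [∀ x, Module ℂ (L x)]
  [∀ x, TopologicalSpace (L x)] [TopologicalSpace (Bundle.TotalSpace ℂ L)]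
  [FiberBundle ℂ L] [VectorBundle ℂ ℂ L]

/-- A smooth Hermitian metric on the complex line bundle `L`. Smoothness is expressed by that of
`s ↦ h(s, s)` on the total space (as a real manifold). -/
structure HermitianMetric where
  /-- The Hermitian inner product of each fibre, linear in the second variable. -/
  inner (x : M) : L x →ₗ⋆[ℂ] L x →ₗ[ℂ] ℂ
  conj_symm (x : M) (s t : L x) : (starRingEnd ℂ) (inner x s t) = inner x t s
  pos (x : M) (s : L x) (hs : s ≠ 0) : 0 < (inner x s s).re
  smooth : ContMDiff (𝓘(ℝ, E).prod 𝓘(ℝ, ℂ)) 𝓘(ℝ, ℝ) ∞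
    (fun p : Bundle.TotalSpace ℂ L ↦ (inner p.1 p.2 p.2).re)

/-- The total space of the dual bundle `L^*`. -/
abbrev DualTotal : Type _ :=
  Bundle.TotalSpace (ℂ →L[ℂ] ℂ) (fun x : M ↦ L x →L[ℂ] Bundle.Trivial M ℂ x)

variable {E L}

namespace HermitianMetric

variable (h : HermitianMetric E L)

/-- `|s|_h² = h(s, s)`. -/
def normSq (x : M) (s : L x) : ℝ := (h.inner x s s).re

/-- The local function representing `h` in the preferred trivialization around `x`, that is
`z ↦ |e(z)|_h²` for the corresponding local holomorphic frame `e`. -/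
def localWeight (x z : M) : ℝ :=
  h.normSq z ((trivializationAt ℂ L x).symm z 1)

/-- The curvature form `-√-1 ∂∂̄ log h`. -/
def curvatureForm (x : M) (u v : TangentSpace 𝓘(ℝ, E) x) : ℝ :=
  -iddbar 𝓘(ℝ, E) (fun z ↦ Real.log (h.localWeight x z)) x u v

/-- The squared norm `|v|²` of `v ∈ L^*` for the dual metric `h⁻¹`:
the supremum of `|v(s)|² / |s|_h²` over `s`. -/
def dualNormSq (v : DualTotal L) : ℝ :=
  ⨆ s : L v.1, ‖(v.2 s : ℂ)‖ ^ 2 / h.normSq v.1 s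

theorem dualNormSq_eq_of_frame (v : DualTotal L) (s : L v.1) (hs : s ≠ 0)
    (hspan : ∀ t : L v.1, ∃ c : ℂ, t = c • s) :
    h.dualNormSq v = ‖(v.2 s : ℂ)‖ ^ 2 / h.normSq v.1 s := by
  have key : ∀ t : L v.1, ‖(v.2 t : ℂ)‖ ^ 2 / h.normSq v.1 t ≤
      ‖(v.2 s : ℂ)‖ ^ 2 / h.normSq v.1 s := by
    intro t
    obtain ⟨c, rfl⟩ := hspan t
    have e1 : h.normSq v.1 (c • s) = ‖c‖ ^ 2 * h.normSq v.1 s := by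
      have : h.inner v.1 (c • s) (c • s) = ((‖c‖ ^ 2 : ℝ) : ℂ) * h.inner v.1 s s := by
        rw [LinearMap.map_smul, LinearMap.map_smulₛₗ₂, smul_eq_mul,
          smul_eq_mul, ← mul_assoc, Complex.mul_conj,
          Complex.normSq_eq_norm_sq]
      rw [normSq, this, Complex.re_ofReal_mul, normSq]
    have e2 : ‖(v.2 (c • s) : ℂ)‖ = ‖c‖ * ‖(v.2 s : ℂ)‖ := by
      have : (v.2 (c • s) : ℂ) = c * (v.2 s : ℂ) := by
        rw [ContinuousLinearMap.map_smul]; rfl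
      rw [this, norm_mul]
    have hp : 0 < h.normSq v.1 s := h.pos _ _ hs
    rw [e1, e2]
    by_cases hc : c = 0
    · subst hc
      simp only [norm_zero, zero_mul, ne_eq, OfNat.ofNat_ne_zero, not_false_eq_true, zero_pow,
        div_zero]
      positivity
    · have : 0 < ‖c‖ := norm_pos_iff.2 hc
      rw [mul_pow, mul_div_mul_left _ _ (by positivity)]
  have : Nonempty (L v.1) := ⟨0⟩
  exact le_antisymm (ciSup_le key)
    (le_ciSup (f := fun t : L v.1 ↦ ‖(v.2 t : ℂ)‖ ^ 2 / h.normSq v.1 t)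
      ⟨_, by rintro _ ⟨t, rfl⟩; exact key t⟩ s)

end HermitianMetric

theorem HermitianMetric.continuous_dualNormSq (h : HermitianMetric E L) :
    Continuous h.dualNormSq := by
  rw [continuous_iff_continuousAt]
  intro v₀
  set x₀ := v₀.1 with hx₀
  set e := trivializationAt ℂ L x₀ with he
  have hbase : e.baseSet ∈ 𝓝 x₀ :=
    e.open_baseSet.mem_nhds (FiberBundle.mem_baseSet_trivializationAt' x₀)
  have hproj : ContinuousAt (fun v : DualTotal L ↦ v.1) v₀ :=
    (FiberBundle.continuous_proj (ℂ →L[ℂ] ℂ)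
      (fun x : M ↦ L x →L[ℂ] Bundle.Trivial M ℂ x)).continuousAt
  have hden : ContinuousAt (fun z ↦ h.normSq z (e.symm z 1)) x₀ := by
    have h1 : ContinuousAt (fun z : M ↦ e.toOpenPartialHomeomorph.symm (z, (1 : ℂ))) x₀ := by
      refine ContinuousAt.comp (x := x₀)
        (g := e.toOpenPartialHomeomorph.symm) (f := fun z : M ↦ (z, (1 : ℂ))) ?_ (by fun_prop)
      refine e.toOpenPartialHomeomorph.continuousAt_symm ?_
      rw [e.mem_target]
      exact FiberBundle.mem_baseSet_trivializationAt' x₀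
    have h2 := h.smooth.continuous.continuousAt.comp (x := x₀) h1
    refine h2.congr ?_
    filter_upwards [hbase] with z hz
    have hm := e.mk_symm hz (1 : ℂ)
    exact congrArg (fun p : Bundle.TotalSpace ℂ L ↦ (h.inner p.1 p.2 p.2).re) hm.symm
  have hnum : ContinuousAt (fun v : DualTotal L ↦ ‖(v.2 (e.symm v.1 1) : ℂ)‖) v₀ := by
    have h1 := (continuousAt_hom_bundle (RingHom.id ℂ) (fun v : DualTotal L ↦ v)
      (x₀ := v₀)).1 continuousAt_id
    have h2 := (h1.2.clm_apply (continuousAt_const (y := (1 : ℂ)))).norm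
    refine h2.congr ?_
    filter_upwards [hproj hbase] with v hv
    congr 1
    rw [ContinuousLinearMap.inCoordinates]
    simp only [ContinuousLinearMap.comp_apply]
    rw [Bundle.Trivialization.continuousLinearMapAt_apply,
      Bundle.Trivialization.linearMapAt_apply,
      if_pos (show v.1 ∈ (trivializationAt ℂ (Bundle.Trivial M ℂ) v₀.1).baseSet from trivial)]
    exact congrArg v.2 (e.symmL_apply (R := ℂ) hv (1 : ℂ))
  have hne : ∀ z ∈ e.baseSet, e.symm z 1 ≠ 0 := by
    intro z hz h0
    have h1 := (e.continuousLinearEquivAt ℂ z hz).symm.injective.ne (one_ne_zero (α := ℂ))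
    rw [map_zero] at h1
    exact h1 h0
  have hq : ContinuousAt (fun v : DualTotal L ↦
      ‖(v.2 (e.symm v.1 1) : ℂ)‖ ^ 2 / h.normSq v.1 (e.symm v.1 1)) v₀ := by
    refine (hnum.pow 2).div
      (ContinuousAt.comp (g := fun z ↦ h.normSq z (e.symm z 1)) (x := v₀) hden hproj) ?_
    exact (h.pos _ _ (hne _ (FiberBundle.mem_baseSet_trivializationAt' x₀))).ne'
  refine hq.congr ?_
  filter_upwards [hproj hbase] with v hv
  refine (h.dualNormSq_eq_of_frame v _ (hne _ hv) fun t ↦ ?_).symm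
  refine ⟨e.continuousLinearEquivAt ℂ v.1 hv t, ?_⟩
  have h1 := (e.continuousLinearEquivAt ℂ v.1 hv).symm_apply_apply t
  have h2 : e.symm v.1 1 = (e.continuousLinearEquivAt ℂ v.1 hv).symm 1 := rfl
  rw [h2, ← map_smul, smul_eq_mul, mul_one, h1]

/-- The disc bundle `D(L^*) = {v ∈ L^* : |v| < 1}`, an open subset of the total space of `L^*`. -/
def discBundle (h : HermitianMetric E L) : TopologicalSpace.Opens (DualTotal L) :=
  ⟨{v | h.dualNormSq v < 1}, isOpen_lt h.continuous_dualNormSq continuous_const⟩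

variable (E) in
/-- The total space of `L^*` has complex dimension `dim M + 1`; this is its model with corners as a
real manifold. -/
abbrev totalModel := (𝓘(ℝ, E).prod 𝓘(ℝ, ℂ →L[ℂ] ℂ))

/-- The projection `π : D(L^*) → M`. -/
def discProj (h : HermitianMetric E L) (p : discBundle h) : M := p.1.1

/-- The form `ω_D = π^* ω_M - √-1 ∂∂̄ log(1 - |v|²)` on the disc bundle, where `ω_M` is the
curvature form of `h`. -/
def discForm (h : HermitianMetric E L) (p : discBundle h)
    (u v : TangentSpace (totalModel E) p) : ℝ :=
  h.curvatureForm (discProj h p)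
      (mfderiv (totalModel E) 𝓘(ℝ, E) (discProj h) p u)
      (mfderiv (totalModel E) 𝓘(ℝ, E) (discProj h) p v)
    - iddbar (totalModel E) (fun q : discBundle h ↦ Real.log (1 - h.dualNormSq q.1)) p u v

end LineBundle

end DiscBundle

end

/-! In a local holomorphic frame `e` of `L`, write `H = |e|_h²`, let `w` be the fibre coordinate of
`L^*` dual to `e`, and put `Q = H - |w|² = H (1 - |v|²)` and `θ = dw - w ∂ log H`. The terms
`-log H` of `ω_M` and of `log (1 - |v|²)` cancel, so that `ω_D = -√-1 ∂∂̄ log Q`, and the associated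
symmetric form is
`g_D = (H / Q) π^* g_M + (2 H / Q²) |θ|²`.
Hence `g_D` is positive definite and `g_D ≥ π^* g_M`. Moreover `∂ log (1 - |v|²) = -conj w θ / Q`,
so the differential of `log (1 - |v|²)` has norm at most `√2` for `g_D`. A Cauchy sequence of `g_D`
therefore projects to a convergent sequence of `M` and stays in a set `|v|² ≤ c` with `c < 1`. Such
a set is proper over `M`, so the sequence has a convergent subsequence. -/

noncomputable section

namespace DiscBundle

section Bilinear

variable {V W : Type*} [NormedAddCommGroup V] [NormedSpace ℝ V]
  [NormedAddCommGroup W] [NormedSpace ℝ W]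

theorem contDiff_flip {n : WithTop ℕ∞} :
    ContDiff ℝ n (ContinuousLinearMap.flip : (V →L[ℝ] W →L[ℝ] ℝ) → W →L[ℝ] V →L[ℝ] ℝ) :=
  IsBoundedLinearMap.contDiff
    ⟨⟨fun _ _ ↦ rfl, fun _ _ ↦ rfl⟩, 1, one_pos, fun B ↦ by rw [B.opNorm_flip, one_mul]⟩

theorem contMDiffAt_bilinearComp_self {E H X : Type*} [NormedAddCommGroup E] [NormedSpace ℝ E]
    [TopologicalSpace H] {I : ModelWithCorners ℝ E H} [TopologicalSpace X] [ChartedSpace H X]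
    {n : WithTop ℕ∞} {B : X → W →L[ℝ] W →L[ℝ] ℝ} {T : X → V →L[ℝ] W} {x : X}
    (hB : ContMDiffAt I 𝓘(ℝ, W →L[ℝ] W →L[ℝ] ℝ) n B x)
    (hT : ContMDiffAt I 𝓘(ℝ, V →L[ℝ] W) n T x) :
    ContMDiffAt I 𝓘(ℝ, V →L[ℝ] V →L[ℝ] ℝ) n (fun z ↦ (B z).bilinearComp (T z) (T z)) x :=
  contDiff_flip.contMDiff.contMDiffAt.comp x
    ((contDiff_flip.contMDiff.contMDiffAt.comp x (hB.clm_comp hT)).clm_comp hT)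

end Bilinear

section LeviForm

variable {V W : Type*} [NormedAddCommGroup V] [NormedSpace ℂ V]
  [NormedAddCommGroup W] [NormedSpace ℂ W]

/-- Multiplication by `i` as a real continuous linear map. -/
def mulI (V : Type*) [NormedAddCommGroup V] [NormedSpace ℂ V] : V →L[ℝ] V :=
  (Complex.I • ContinuousLinearMap.id ℂ V).restrictScalars ℝ

/-- The Levi form of `f` at `y`, as the part of the real Hessian that is invariant under
multiplication by `i`. With this normalization `√-1 ∂∂̄ f (u, v)` is its value at `(i u, v)`. -/
def leviForm (f : V → ℝ) (y : V) : V →L[ℝ] V →L[ℝ] ℝ :=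
  (1 / 2 : ℝ) • (fderiv ℝ (fderiv ℝ f) y + (fderiv ℝ (fderiv ℝ f) y).bilinearComp (mulI V) (mulI V))

/-- The value at `u` of the `(1, 0)`-part `∂f` of the differential of `f` at `y`. -/
def del (f : V → ℝ) (y u : V) : ℂ :=
  (fderiv ℝ f y u - Complex.I * fderiv ℝ f y (Complex.I • u)) / 2

theorem leviForm_apply (f : V → ℝ) (y u v : V) :
    leviForm f y u v = (fderiv ℝ (fderiv ℝ f) y u v +
      fderiv ℝ (fderiv ℝ f) y (Complex.I • u) (Complex.I • v)) / 2 :=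
  one_div_mul_eq_div _ _

theorem leviForm_symm {f : V → ℝ} {y : V} (hf : ContDiffAt ℝ 2 f y) (u v : V) :
    leviForm f y u v = leviForm f y v u := by
  have h : IsSymmSndFDerivAt ℝ f y := hf.isSymmSndFDerivAt (by simp)
  rw [leviForm_apply, leviForm_apply, h.eq u v, h.eq (Complex.I • u)]

theorem leviForm_I_smul (f : V → ℝ) (y u v : V) :
    leviForm f y (Complex.I • u) (Complex.I • v) = leviForm f y u v := by
  simp only [leviForm_apply, smul_smul, Complex.I_mul_I, neg_smul, one_smul, map_neg,
    neg_apply, neg_neg, add_comm]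

theorem leviForm_congr {f g : V → ℝ} {y : V} (h : f =ᶠ[𝓝 y] g) :
    leviForm f y = leviForm g y := by
  rw [leviForm, leviForm, h.fderiv.fderiv_eq]

theorem contDiffAt_leviForm {f : V → ℝ} {y : V} (hf : ContDiffAt ℝ ∞ f y) :
    ContDiffAt ℝ ∞ (leviForm f) y := by
  have hessian : ContDiffAt ℝ ∞ (fderiv ℝ (fderiv ℝ f)) y :=
    (hf.fderiv_right (m := ∞) (by simp)).fderiv_right (m := ∞) (by simp)
  have hessian_I : ContDiffAt ℝ ∞
      (fun x ↦ (fderiv ℝ (fderiv ℝ f) x).bilinearComp (mulI V) (mulI V)) y :=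
    (contMDiffAt_bilinearComp_self hessian.contMDiffAt contMDiffAt_const).contDiffAt
  exact (hessian.add hessian_I).const_smul (1 / 2 : ℝ)

theorem differentiableAt_fderiv {f : V → ℝ} {y : V} (hf : ContDiffAt ℝ 2 f y) :
    DifferentiableAt ℝ (fderiv ℝ f) y :=
  (hf.fderiv_right (m := 1) (by norm_num)).differentiableAt one_ne_zero

theorem leviForm_sub {f g : V → ℝ} {y : V} (hf : ContDiffAt ℝ 2 f y) (hg : ContDiffAt ℝ 2 g y)
    (u v : V) :
    leviForm (fun x ↦ f x - g x) y u v = leviForm f y u v - leviForm g y u v := by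
  have hfg : fderiv ℝ (fun x ↦ f x - g x) =ᶠ[𝓝 y] fun x ↦ fderiv ℝ f x - fderiv ℝ g x := by
    filter_upwards [hf.eventually (by simp), hg.eventually (by simp)] with x hfx hgx
    exact fderiv_fun_sub (hfx.differentiableAt (by simp)) (hgx.differentiableAt (by simp))
  simp only [leviForm_apply, hfg.fderiv_eq,
    fderiv_fun_sub (differentiableAt_fderiv hf) (differentiableAt_fderiv hg), sub_apply]
  ring

theorem fderiv_comp_holomorphic {f : W → ℝ} {φ : V → W} {y : V}
    (hf : DifferentiableAt ℝ f (φ y)) (hφ : DifferentiableAt ℂ φ y) :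
    fderiv ℝ (f ∘ φ) y = (fderiv ℝ f (φ y)).comp
      (ContinuousLinearMap.restrictScalarsL ℂ V W ℝ ℝ (fderiv ℂ φ y)) :=
  (hf.hasFDerivAt.comp y (hφ.hasFDerivAt.restrictScalars ℝ)).fderiv

theorem fderiv_fderiv_comp_holomorphic {f : W → ℝ} {φ : V → W} {y : V}
    (hf : ContDiffAt ℝ 2 f (φ y)) (hφ : ContDiffAt ℂ 2 φ y) (u v : V) :
    fderiv ℝ (fderiv ℝ (f ∘ φ)) y u v =
      fderiv ℝ f (φ y) (fderiv ℂ (fderiv ℂ φ) y u v) +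
        fderiv ℝ (fderiv ℝ f) (φ y) (fderiv ℂ φ y u) (fderiv ℂ φ y v) := by
  have hfφ : fderiv ℝ (f ∘ φ) =ᶠ[𝓝 y] fun x ↦ (fderiv ℝ f (φ x)).comp
      (ContinuousLinearMap.restrictScalarsL ℂ V W ℝ ℝ (fderiv ℂ φ x)) := by
    filter_upwards [hφ.continuousAt.eventually (hf.eventually (by simp)),
      hφ.eventually (by simp)] with x hfx hφx
    exact fderiv_comp_holomorphic (hfx.differentiableAt (by simp)) (hφx.differentiableAt (by simp))
  have hdf : HasFDerivAt (fun x ↦ fderiv ℝ f (φ x)) _ y :=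
    (differentiableAt_fderiv hf).hasFDerivAt.comp y
      ((hφ.differentiableAt (by simp)).hasFDerivAt.restrictScalars ℝ)
  have hdφ : HasFDerivAt
      (fun x ↦ ContinuousLinearMap.restrictScalarsL ℂ V W ℝ ℝ (fderiv ℂ φ x)) _ y :=
    (ContinuousLinearMap.restrictScalarsL ℂ V W ℝ ℝ).hasFDerivAt.comp y
      (((hφ.fderiv_right (m := 1) (by norm_num)).differentiableAt
        one_ne_zero).hasFDerivAt.restrictScalars ℝ)
  rw [hfφ.fderiv_eq, (hdf.clm_comp hdφ).fderiv]
  rfl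

theorem leviForm_comp {f : W → ℝ} {φ : V → W} {y : V} (hf : ContDiffAt ℝ 2 f (φ y))
    (hφ : ContDiffAt ℂ 2 φ y) (u v : V) :
    leviForm (f ∘ φ) y u v = leviForm f (φ y) (fderiv ℂ φ y u) (fderiv ℂ φ y v) := by
  -- The term `df (D²φ (u, v))` cancels because `D²φ` is complex bilinear.
  simp only [leviForm_apply, fderiv_fderiv_comp_holomorphic hf hφ, map_smul, smul_apply,
    smul_smul, Complex.I_mul_I, neg_smul, one_smul, map_neg]
  ring

theorem leviForm_norm_sq (w u : ℂ) : leviForm (fun x : ℂ ↦ ‖x‖ ^ 2) w u u = 2 * ‖u‖ ^ 2 := by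
  have hessian (a : ℂ) : fderiv ℝ (fderiv ℝ (fun x : ℂ ↦ ‖x‖ ^ 2)) w a a = 2 * ‖a‖ ^ 2 := by
    have hfderiv : fderiv ℝ (fun x : ℂ ↦ ‖x‖ ^ 2) = (2 • innerSL ℝ : ℂ →L[ℝ] ℂ →L[ℝ] ℝ) :=
      fderiv_norm_sq
    rw [hfderiv, ContinuousLinearMap.fderiv, ← real_inner_self_eq_norm_sq a, two_mul, two_smul]
    rfl
  rw [leviForm_apply, hessian, hessian, norm_smul, Complex.norm_I, one_mul, add_self_div_two]

theorem two_mul_re_del (f : V → ℝ) (y u : V) : 2 * (del f y u).re = fderiv ℝ f y u := by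
  simp only [del, Complex.div_ofNat_re, Complex.sub_re, Complex.mul_re, Complex.ofReal_re,
    Complex.ofReal_im, Complex.I_re, Complex.I_im]
  ring

theorem four_mul_norm_del_sq (f : V → ℝ) (y u : V) :
    4 * ‖del f y u‖ ^ 2 = fderiv ℝ f y u ^ 2 + fderiv ℝ f y (Complex.I • u) ^ 2 := by
  rw [← Complex.normSq_eq_norm_sq, Complex.normSq_apply]
  simp only [del, Complex.div_ofNat_re, Complex.div_ofNat_im, Complex.sub_re, Complex.sub_im,
    Complex.mul_re, Complex.mul_im, Complex.ofReal_re, Complex.ofReal_im, Complex.I_re,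
    Complex.I_im]
  ring

theorem norm_del_le (f : V → ℝ) (y u : V) : ‖del f y u‖ ≤ ‖fderiv ℝ f y‖ * ‖u‖ := by
  have hu := (fderiv ℝ f y).le_opNorm u
  have hIu := (fderiv ℝ f y).le_opNorm (Complex.I • u)
  rw [norm_smul, Complex.norm_I, one_mul] at hIu
  calc ‖del f y u‖ ≤ (‖fderiv ℝ f y u‖ + ‖fderiv ℝ f y (Complex.I • u)‖) / 2 := by
        rw [del, norm_div, Complex.norm_ofNat]
        gcongr
        refine (norm_sub_le _ _).trans_eq ?_
        rw [norm_mul, Complex.norm_I, one_mul, Complex.norm_real, Complex.norm_real]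
    _ ≤ ‖fderiv ℝ f y‖ * ‖u‖ := by linarith

theorem del_zero_right (f : V → ℝ) (y : V) : del f y 0 = 0 := by
  simp [del]

theorem del_sub {f g : V → ℝ} {y : V} (hf : DifferentiableAt ℝ f y) (hg : DifferentiableAt ℝ g y)
    (u : V) : del (fun x ↦ f x - g x) y u = del f y u - del g y u := by
  simp only [del, fderiv_fun_sub hf hg, sub_apply, Complex.ofReal_sub]
  ring

theorem del_comp {f : W → ℝ} {φ : V → W} {y : V} (hf : DifferentiableAt ℝ f (φ y))
    (hφ : DifferentiableAt ℂ φ y) (u : V) :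
    del (f ∘ φ) y u = del f (φ y) (fderiv ℂ φ y u) := by
  simp [del, fderiv_comp_holomorphic hf hφ]

theorem del_norm_sq (w u : ℂ) :
    del (fun x : ℂ ↦ ‖x‖ ^ 2) w u = starRingEnd ℂ w * u := by
  have fderiv_eq (a : ℂ) :
      fderiv ℝ (fun x : ℂ ↦ ‖x‖ ^ 2) w a = 2 * (starRingEnd ℂ w * a).re := by
    rw [mul_comm (starRingEnd ℂ w), ← Complex.inner, fderiv_norm_sq_apply, smul_apply,
      two_smul, two_mul]
    rfl
  rw [del, fderiv_eq, fderiv_eq, smul_eq_mul, mul_left_comm, Complex.I_mul_re]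
  push_cast
  linear_combination Complex.re_add_im (starRingEnd ℂ w * u)

theorem del_log {q : V → ℝ} {y : V} (hq : DifferentiableAt ℝ q y) (h0 : q y ≠ 0) (u : V) :
    del (fun x ↦ Real.log (q x)) y u = del q y u / q y := by
  have hfderiv : fderiv ℝ (fun x ↦ Real.log (q x)) y = (q y)⁻¹ • fderiv ℝ q y :=
    (hq.hasFDerivAt.log h0).fderiv
  simp only [del, hfderiv, smul_apply, smul_eq_mul, Complex.ofReal_mul, Complex.ofReal_inv]
  ring

theorem leviForm_log {q : V → ℝ} {y : V} (hq : ContDiffAt ℝ 2 q y) (h0 : q y ≠ 0) (u : V) :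
    leviForm (fun x ↦ Real.log (q x)) y u u =
      leviForm q y u u / q y - 2 * ‖del q y u‖ ^ 2 / q y ^ 2 := by
  have hlog : fderiv ℝ (fun x ↦ Real.log (q x)) =ᶠ[𝓝 y] fun x ↦ (q x)⁻¹ • fderiv ℝ q x := by
    filter_upwards [hq.eventually (by simp), hq.continuousAt.eventually_ne h0] with x hqx hx
    exact ((hqx.differentiableAt (by simp)).hasFDerivAt.log hx).fderiv
  have hinv : HasFDerivAt (fun x ↦ (q x)⁻¹) _ y :=
    (hasDerivAt_inv h0).comp_hasFDerivAt y (hq.differentiableAt (by simp)).hasFDerivAt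
  have hessian (a : V) : fderiv ℝ (fderiv ℝ (fun x ↦ Real.log (q x))) y a a =
      fderiv ℝ (fderiv ℝ q) y a a / q y - fderiv ℝ q y a ^ 2 / q y ^ 2 := by
    rw [hlog.fderiv_eq, (hinv.fun_smul (differentiableAt_fderiv hq).hasFDerivAt).fderiv]
    simp only [neg_smul, add_apply, smul_apply, ContinuousLinearMap.smulRight_apply, neg_apply,
      smul_eq_mul]
    field_simp
    ring
  have hdel := four_mul_norm_del_sq q y u
  rw [leviForm_apply, leviForm_apply, hessian, hessian]
  field_simp
  linarith

end LeviForm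

section DiscPotential

variable {E F : Type*} [NormedAddCommGroup E] [NormedSpace ℂ E]
  [NormedAddCommGroup F] [NormedSpace ℂ F]

/-- The function `H - |ℓ|²` on a product, where `ℓ` is a linear coordinate on the second factor.
If `H = |e|_h²` in a local frame `e` of `L` and `ℓ v = v(e)`, this is `H (1 - |v|²)`. -/
def discPotential (H : E → ℝ) (ℓ : F →L[ℂ] ℂ) (x : E × F) : ℝ := H x.1 - ‖ℓ x.2‖ ^ 2

/-- The connection form `dw - w ∂ log H` of the Chern connection of the dual metric, where `w = ℓ`
is the fibre coordinate and `H` is the weight of the metric of the line bundle. -/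
def connectionForm (H : E → ℝ) (ℓ : F →L[ℂ] ℂ) (y u : E × F) : ℂ :=
  ℓ u.2 - ℓ y.2 * del (fun x ↦ Real.log (H x)) y.1 u.1

theorem leviForm_comp_fst {f : E → ℝ} {y : E × F} (hf : ContDiffAt ℝ 2 f y.1) (u v : E × F) :
    leviForm (fun x : E × F ↦ f x.1) y u v = leviForm f y.1 u.1 v.1 := by
  have h := leviForm_comp (φ := (Prod.fst : E × F → E)) hf contDiffAt_fst u v
  rwa [fderiv_fst] at h

theorem del_comp_fst {f : E → ℝ} {y : E × F} (hf : DifferentiableAt ℝ f y.1) (u : E × F) :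
    del (fun x : E × F ↦ f x.1) y u = del f y.1 u.1 := by
  have h := del_comp (φ := (Prod.fst : E × F → E)) hf differentiableAt_fst u
  rwa [fderiv_fst] at h

theorem leviForm_norm_sq_comp (ℓ : F →L[ℂ] ℂ) (y u : F) :
    leviForm (fun x ↦ ‖ℓ x‖ ^ 2) y u u = 2 * ‖ℓ u‖ ^ 2 := by
  have h := leviForm_comp (f := fun x : ℂ ↦ ‖x‖ ^ 2) (contDiff_norm_sq ℝ).contDiffAt
    (ℓ.contDiff.contDiffAt (x := y)) u u
  rwa [ContinuousLinearMap.fderiv, leviForm_norm_sq] at h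

theorem del_norm_sq_comp (ℓ : F →L[ℂ] ℂ) (y u : F) :
    del (fun x ↦ ‖ℓ x‖ ^ 2) y u = starRingEnd ℂ (ℓ y) * ℓ u := by
  have h := del_comp (f := fun x : ℂ ↦ ‖x‖ ^ 2)
    ((contDiff_norm_sq ℝ (n := 1)).contDiffAt.differentiableAt one_ne_zero)
    (ℓ.differentiableAt (x := y)) u
  rwa [ContinuousLinearMap.fderiv, del_norm_sq] at h

theorem contDiff_norm_sq_snd (ℓ : F →L[ℂ] ℂ) {n : WithTop ℕ∞} :
    ContDiff ℝ n (fun x : E × F ↦ ‖ℓ x.2‖ ^ 2) :=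
  ((ℓ.comp (ContinuousLinearMap.snd ℂ E F)).restrictScalars ℝ).contDiff.norm_sq ℝ

variable {H : E → ℝ} {ℓ : F →L[ℂ] ℂ} {y : E × F}

theorem contDiffAt_discPotential {n : WithTop ℕ∞} (hH : ContDiffAt ℝ n H y.1) :
    ContDiffAt ℝ n (discPotential H ℓ) y :=
  (hH.comp y contDiffAt_fst).sub (contDiff_norm_sq_snd ℓ).contDiffAt

theorem leviForm_discPotential (hH : ContDiffAt ℝ 2 H y.1) (u : E × F) :
    leviForm (discPotential H ℓ) y u u = leviForm H y.1 u.1 u.1 - 2 * ‖ℓ u.2‖ ^ 2 :=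
  (leviForm_sub (hH.comp y contDiffAt_fst) (contDiff_norm_sq_snd ℓ).contDiffAt u u).trans
    (congrArg₂ _ (leviForm_comp_fst hH u u)
      (leviForm_norm_sq_comp (ℓ.comp (ContinuousLinearMap.snd ℂ E F)) y u))

theorem del_discPotential (hH : DifferentiableAt ℝ H y.1) (u : E × F) :
    del (discPotential H ℓ) y u = del H y.1 u.1 - starRingEnd ℂ (ℓ y.2) * ℓ u.2 :=
  (del_sub (hH.comp y differentiableAt_fst)
    ((contDiff_norm_sq_snd ℓ (n := 1)).contDiffAt.differentiableAt one_ne_zero) u).trans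
    (congrArg₂ _ (del_comp_fst hH u)
      (del_norm_sq_comp (ℓ.comp (ContinuousLinearMap.snd ℂ E F)) y u))

theorem mul_norm_sq_add_norm_sub_conj_mul_sq (w ξ η : ℂ) (Q : ℝ) :
    (Q + ‖w‖ ^ 2) * (Q * ‖ξ‖ ^ 2 + ‖η - starRingEnd ℂ w * ξ‖ ^ 2) =
      Q * ‖η‖ ^ 2 + ‖(Q + ‖w‖ ^ 2 : ℝ) * ξ - w * η‖ ^ 2 := by
  simp only [← Complex.normSq_eq_norm_sq, Complex.normSq_apply, Complex.sub_re, Complex.sub_im,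
    Complex.mul_re, Complex.mul_im, Complex.conj_re, Complex.conj_im, Complex.ofReal_re,
    Complex.ofReal_im]
  ring

theorem weight_mul_connectionForm (hH : DifferentiableAt ℝ H y.1) (h0 : H y.1 ≠ 0) (u : E × F) :
    H y.1 * connectionForm H ℓ y u = H y.1 * ℓ u.2 - ℓ y.2 * del H y.1 u.1 := by
  have h0' : (H y.1 : ℂ) ≠ 0 := Complex.ofReal_ne_zero.2 h0
  rw [connectionForm, del_log hH h0]
  field_simp

theorem neg_leviForm_log_discPotential (hH : ContDiffAt ℝ 2 H y.1) (hpos : 0 < H y.1)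
    (hQ : 0 < discPotential H ℓ y) (u : E × F) :
    -leviForm (fun x ↦ Real.log (discPotential H ℓ x)) y u u =
      H y.1 / discPotential H ℓ y * -leviForm (fun x ↦ Real.log (H x)) y.1 u.1 u.1 +
      2 * H y.1 / discPotential H ℓ y ^ 2 * ‖connectionForm H ℓ y u‖ ^ 2 := by
  have hHd : DifferentiableAt ℝ H y.1 := hH.differentiableAt two_ne_zero
  have hsum : discPotential H ℓ y + ‖ℓ y.2‖ ^ 2 = H y.1 := sub_add_cancel _ _
  have norm_weight_mul_connectionForm : ‖H y.1 * ℓ u.2 - ℓ y.2 * del H y.1 u.1‖ ^ 2 =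
      H y.1 ^ 2 * ‖connectionForm H ℓ y u‖ ^ 2 := by
    rw [← weight_mul_connectionForm hHd hpos.ne', norm_mul, Complex.norm_real, mul_pow,
      Real.norm_of_nonneg hpos.le]
  have hsq := mul_norm_sq_add_norm_sub_conj_mul_sq (ℓ y.2) (ℓ u.2) (del H y.1 u.1)
    (discPotential H ℓ y)
  rw [hsum, norm_weight_mul_connectionForm] at hsq
  rw [leviForm_log (contDiffAt_discPotential hH) hQ.ne', leviForm_log hH hpos.ne',
    leviForm_discPotential hH, del_discPotential hHd]
  field_simp
  linear_combination 2 * hsq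

theorem del_log_sub_log_discPotential (hH : DifferentiableAt ℝ H y.1) (hpos : 0 < H y.1)
    (hQ : 0 < discPotential H ℓ y) (u : E × F) :
    del (fun x : E × F ↦ Real.log (discPotential H ℓ x) - Real.log (H x.1)) y u =
      -(starRingEnd ℂ (ℓ y.2) * connectionForm H ℓ y u / discPotential H ℓ y) := by
  have hQd : DifferentiableAt ℝ (discPotential H ℓ) y :=
    (hH.comp y differentiableAt_fst).sub
      ((contDiff_norm_sq_snd ℓ (n := 1)).contDiffAt.differentiableAt one_ne_zero)
  have hsum : (H y.1 : ℂ) = discPotential H ℓ y + ℓ y.2 * starRingEnd ℂ (ℓ y.2) := by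
    rw [Complex.mul_conj, Complex.normSq_eq_norm_sq, ← Complex.ofReal_add, discPotential,
      sub_add_cancel]
  have hconn := weight_mul_connectionForm (ℓ := ℓ) hH hpos.ne' u
  have hH0 : (H y.1 : ℂ) ≠ 0 := Complex.ofReal_ne_zero.2 hpos.ne'
  have hQ0 : (discPotential H ℓ y : ℂ) ≠ 0 := Complex.ofReal_ne_zero.2 hQ.ne'
  have hlogH : DifferentiableAt ℝ (fun x : E × F ↦ Real.log (H x.1)) y :=
    (hH.log hpos.ne').comp y differentiableAt_fst
  rw [del_sub (hQd.log hQ.ne') hlogH, del_log hQd hQ.ne',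
    del_comp_fst (f := fun x ↦ Real.log (H x)) (hH.log hpos.ne'), del_log hH hpos.ne',
    del_discPotential hH]
  field_simp
  linear_combination starRingEnd ℂ (ℓ y.2) * hconn + del H y.1 u.1 * hsum

theorem fderiv_log_sub_log_discPotential_sq_le (hH : ContDiffAt ℝ 2 H y.1) (hpos : 0 < H y.1)
    (hQ : 0 < discPotential H ℓ y) (u : E × F)
    (hω : 0 ≤ -leviForm (fun x ↦ Real.log (H x)) y.1 u.1 u.1) :
    fderiv ℝ (fun x : E × F ↦ Real.log (discPotential H ℓ x) - Real.log (H x.1)) y u ^ 2 ≤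
      2 * -leviForm (fun x ↦ Real.log (discPotential H ℓ x)) y u u := by
  set Q := discPotential H ℓ y
  set θ := connectionForm H ℓ y u
  have norm_fibre_sq_le : ‖ℓ y.2‖ ^ 2 ≤ H y.1 := by
    rw [← sub_nonneg]
    exact hQ.le
  calc _ = 4 * ((-(starRingEnd ℂ (ℓ y.2) * θ / Q)).re) ^ 2 := by
        rw [← two_mul_re_del,
          del_log_sub_log_discPotential (hH.differentiableAt two_ne_zero) hpos hQ]
        ring
    _ ≤ 4 * ‖-(starRingEnd ℂ (ℓ y.2) * θ / Q)‖ ^ 2 :=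
        mul_le_mul_of_nonneg_left
          (sq_le_sq.2 ((Complex.abs_re_le_norm _).trans (le_abs_self _))) zero_le_four
    _ = 4 * ‖ℓ y.2‖ ^ 2 / Q ^ 2 * ‖θ‖ ^ 2 := by
        rw [norm_neg, norm_div, norm_mul, Complex.norm_conj, Complex.norm_real,
          Real.norm_of_nonneg hQ.le]
        ring
    _ ≤ 4 * H y.1 / Q ^ 2 * ‖θ‖ ^ 2 := by gcongr
    _ ≤ 2 * (H y.1 / Q * -leviForm (fun x ↦ Real.log (H x)) y.1 u.1 u.1 +
          2 * H y.1 / Q ^ 2 * ‖θ‖ ^ 2) := by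
        have := mul_nonneg (div_nonneg hpos.le hQ.le) hω
        linear_combination 2 * this
    _ = _ := by rw [neg_leviForm_log_discPotential hH hpos hQ]

theorem neg_leviForm_log_weight_le (hH : ContDiffAt ℝ 2 H y.1) (hpos : 0 < H y.1)
    (hQ : 0 < discPotential H ℓ y) (u : E × F)
    (hω : 0 ≤ -leviForm (fun x ↦ Real.log (H x)) y.1 u.1 u.1) :
    -leviForm (fun x ↦ Real.log (H x)) y.1 u.1 u.1 ≤
      -leviForm (fun x ↦ Real.log (discPotential H ℓ x)) y u u := by
  rw [neg_leviForm_log_discPotential hH hpos hQ]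
  have one_le : 1 ≤ H y.1 / discPotential H ℓ y :=
    (one_le_div hQ).2 (sub_le_self _ (sq_nonneg _))
  exact (le_mul_of_one_le_left hω one_le).trans (le_add_of_nonneg_right (by positivity))

theorem two_mul_norm_connectionForm_sq_le (hH : ContDiffAt ℝ 2 H y.1) (hpos : 0 < H y.1)
    (hQ : 0 < discPotential H ℓ y) (u : E × F)
    (hω : 0 ≤ -leviForm (fun x ↦ Real.log (H x)) y.1 u.1 u.1) :
    2 * H y.1 / discPotential H ℓ y ^ 2 * ‖connectionForm H ℓ y u‖ ^ 2 ≤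
      -leviForm (fun x ↦ Real.log (discPotential H ℓ x)) y u u := by
  rw [neg_leviForm_log_discPotential hH hpos hQ]
  exact le_add_of_nonneg_left (mul_nonneg (div_nonneg hpos.le hQ.le) hω)

theorem neg_leviForm_log_discPotential_pos (hℓ : Function.Injective ℓ)
    (hH : ContDiffAt ℝ 2 H y.1) (hpos : 0 < H y.1) (hQ : 0 < discPotential H ℓ y)
    (hω : ∀ v ≠ 0, 0 < -leviForm (fun x ↦ Real.log (H x)) y.1 v v) {u : E × F} (hu : u ≠ 0) :
    0 < -leviForm (fun x ↦ Real.log (discPotential H ℓ x)) y u u := by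
  rw [neg_leviForm_log_discPotential hH hpos hQ]
  by_cases horizontal : u.1 = 0
  · have vertical : u.2 ≠ 0 := fun h ↦ hu (Prod.ext horizontal h)
    have hθ : connectionForm H ℓ y u = ℓ u.2 := by
      rw [connectionForm, horizontal, del_zero_right, mul_zero, sub_zero]
    have norm_pos : 0 < ‖ℓ u.2‖ := norm_pos_iff.2 ((map_ne_zero_iff ℓ hℓ).2 vertical)
    rw [hθ, horizontal, map_zero, neg_zero, mul_zero, zero_add]
    positivity
  · have := hω u.1 horizontal
    positivity

theorem norm_coord_le_norm_connectionForm_add (H : E → ℝ) (ℓ : F →L[ℂ] ℂ) (y u : E × F) :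
    ‖ℓ u.2‖ ≤ ‖connectionForm H ℓ y u‖ +
      ‖ℓ y.2‖ * (‖fderiv ℝ (fun x ↦ Real.log (H x)) y.1‖ * ‖u.1‖) :=
  calc ‖ℓ u.2‖ = ‖connectionForm H ℓ y u + ℓ y.2 * del (fun x ↦ Real.log (H x)) y.1 u.1‖ := by
        rw [connectionForm, sub_add_cancel]
    _ ≤ ‖connectionForm H ℓ y u‖ + ‖ℓ y.2‖ * ‖del (fun x ↦ Real.log (H x)) y.1 u.1‖ :=
        (norm_add_le _ _).trans_eq (by rw [norm_mul])
    _ ≤ _ := by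
        gcongr
        exact norm_del_le _ _ _

theorem isBounded_neg_leviForm_log_discPotential {K : NNReal} (hℓ : AntilipschitzWith K ℓ)
    (hH : ContDiffAt ℝ 2 H y.1) (hpos : 0 < H y.1) (hQ : 0 < discPotential H ℓ y)
    (hω : ∀ v, 0 ≤ -leviForm (fun x ↦ Real.log (H x)) y.1 v v)
    (hbdd : Bornology.IsBounded {v | -leviForm (fun x ↦ Real.log (H x)) y.1 v v < 1}) :
    Bornology.IsBounded
      {u | -leviForm (fun x ↦ Real.log (discPotential H ℓ x)) y u u < 1} := by
  obtain ⟨R, hR⟩ := hbdd.exists_norm_le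
  set D := ‖fderiv ℝ (fun x ↦ Real.log (H x)) y.1‖
  set c := 2 * H y.1 / discPotential H ℓ y ^ 2
  have hc : 0 < c := by positivity
  have fibre : Bornology.IsBounded
      (ℓ ⁻¹' Metric.closedBall 0 (√(1 / c) + ‖ℓ y.2‖ * (D * R))) :=
    hℓ.isBounded_preimage Metric.isBounded_closedBall
  refine ((Metric.isBounded_closedBall (x := (0 : E)) (r := R)).prod fibre).subset fun u hu ↦ ?_
  have norm_fst_le : ‖u.1‖ ≤ R :=
    hR _ ((neg_leviForm_log_weight_le hH hpos hQ u (hω u.1)).trans_lt hu)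
  have norm_connectionForm_le : ‖connectionForm H ℓ y u‖ ≤ √(1 / c) :=
    Real.le_sqrt_of_sq_le ((le_div_iff₀' hc).2
      ((two_mul_norm_connectionForm_sq_le hH hpos hQ u (hω u.1)).trans (le_of_lt hu)))
  have norm_coord_le : ‖ℓ u.2‖ ≤ √(1 / c) + ‖ℓ y.2‖ * (D * R) :=
    (norm_coord_le_norm_connectionForm_add H ℓ y u).trans (by gcongr)
  exact ⟨mem_closedBall_zero_iff.2 norm_fst_le, mem_closedBall_zero_iff.2 norm_coord_le⟩

end DiscPotential

section SmoothForms

variable {V : Type*} [NormedAddCommGroup V] [NormedSpace ℝ V] {H : Type*} [TopologicalSpace H]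
  {I : ModelWithCorners ℝ V H} {X : Type*} [TopologicalSpace X] [ChartedSpace H X]
  {V' : Type*} [NormedAddCommGroup V'] [NormedSpace ℝ V'] {H' : Type*} [TopologicalSpace H']
  {I' : ModelWithCorners ℝ V' H'} {Y : Type*} [TopologicalSpace Y] [ChartedSpace H' Y]

/-- The pullback by the differential of `φ` of a field `B` of bilinear forms on tangent spaces. -/
def pullbackForm (φ : X → Y)
    (B : ∀ y : Y, TangentSpace I' y →L[ℝ] TangentSpace I' y →L[ℝ] ℝ) (x : X) :
    TangentSpace I x →L[ℝ] TangentSpace I x →L[ℝ] ℝ :=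
  ContinuousLinearMap.bilinearComp (E := V') (F := V') (E' := V) (F' := V)
    (B (φ x)) (mfderiv I I' φ x) (mfderiv I I' φ x)

theorem pullbackForm_apply (φ : X → Y)
    (B : ∀ y : Y, TangentSpace I' y →L[ℝ] TangentSpace I' y →L[ℝ] ℝ) (x : X)
    (u v : TangentSpace I x) :
    pullbackForm φ B x u v = B (φ x) (mfderiv I I' φ x u) (mfderiv I I' φ x v) :=
  rfl

variable [IsManifold I ∞ X] [IsManifold I' ∞ Y]

/-- A field `B` of bilinear forms on the tangent spaces of `X` is smooth, as a section of the
bundle of bilinear forms. -/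
def IsSmoothForm (B : ∀ x : X, TangentSpace I x →L[ℝ] TangentSpace I x →L[ℝ] ℝ) : Prop :=
  ContMDiff I (I.prod 𝓘(ℝ, V →L[ℝ] V →L[ℝ] ℝ)) ∞ (fun x ↦
    Bundle.TotalSpace.mk' (V →L[ℝ] V →L[ℝ] ℝ)
      (E := fun x : X ↦ TangentSpace I x →L[ℝ] TangentSpace I x →L[ℝ] ℝ) x (B x))

/-- The expression at `x` of a field of bilinear forms in the preferred trivialization of the
tangent bundle around `x₀`. -/
def coordForm (B : ∀ x : X, TangentSpace I x →L[ℝ] TangentSpace I x →L[ℝ] ℝ) (x₀ x : X) :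
    V →L[ℝ] V →L[ℝ] ℝ :=
  ContinuousLinearMap.bilinearComp (E := V) (F := V) (B x)
    ((trivializationAt V (TangentSpace I) x₀).symmL ℝ x)
    ((trivializationAt V (TangentSpace I) x₀).symmL ℝ x)

theorem coordForm_apply (B : ∀ x : X, TangentSpace I x →L[ℝ] TangentSpace I x →L[ℝ] ℝ) (x₀ x : X)
    (u v : V) :
    coordForm B x₀ x u v =
      B x ((trivializationAt V (TangentSpace I) x₀).symmL ℝ x u)
        ((trivializationAt V (TangentSpace I) x₀).symmL ℝ x v) :=
  rfl

theorem isSmoothForm_iff_coordForm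
    {B : ∀ x : X, TangentSpace I x →L[ℝ] TangentSpace I x →L[ℝ] ℝ} :
    IsSmoothForm B ↔
      ∀ x₀, ContMDiffAt I 𝓘(ℝ, V →L[ℝ] V →L[ℝ] ℝ) ∞ (coordForm B x₀) x₀ := by
  refine forall_congr' fun x₀ ↦ ?_
  refine (contMDiffAt_hom_bundle _).trans ((and_iff_right contMDiffAt_id).trans
    (Filter.EventuallyEq.contMDiffAt_iff ?_))
  have mem_baseSet : ∀ᶠ x in 𝓝 x₀, x ∈ (trivializationAt V (TangentSpace I) x₀).baseSet :=
    (trivializationAt V (TangentSpace I) x₀).open_baseSet.mem_nhds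
      (FiberBundle.mem_baseSet_trivializationAt' x₀)
  filter_upwards [mem_baseSet] with x hx
  ext u v
  refine (inCoordinates_apply_eq₂ (E₃ := fun _ : X ↦ ℝ) hx hx (Set.mem_univ _)).trans ?_
  rw [coordForm_apply, Bundle.Trivialization.symmL_apply _ hx,
    Bundle.Trivialization.symmL_apply _ hx]
  simp

theorem IsSmoothForm.sub {B C : ∀ x : X, TangentSpace I x →L[ℝ] TangentSpace I x →L[ℝ] ℝ}
    (hB : IsSmoothForm B) (hC : IsSmoothForm C) : IsSmoothForm (fun x ↦ B x - C x) :=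
  hB.sub_section hC

theorem coordForm_pullbackForm (φ : X → Y)
    (B : ∀ y : Y, TangentSpace I' y →L[ℝ] TangentSpace I' y →L[ℝ] ℝ) {x₀ x : X}
    (hx : φ x ∈ (trivializationAt V' (TangentSpace I') (φ x₀)).baseSet) :
    coordForm (pullbackForm (I := I) φ B) x₀ x =
      (coordForm B (φ x₀) (φ x)).bilinearComp
        (inTangentCoordinates I I' id φ (mfderiv I I' φ) x₀ x)
        (inTangentCoordinates I I' id φ (mfderiv I I' φ) x₀ x) := by
  have hT (w : V) : (trivializationAt V' (TangentSpace I') (φ x₀)).symmL ℝ (φ x)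
      (inTangentCoordinates I I' id φ (mfderiv I I' φ) x₀ x w) =
        mfderiv I I' φ x ((trivializationAt V (TangentSpace I) x₀).symmL ℝ x w) :=
    Bundle.Trivialization.symmL_continuousLinearMapAt _ hx _
  ext u v
  rw [coordForm_apply, pullbackForm_apply, ContinuousLinearMap.bilinearComp_apply,
    coordForm_apply, hT, hT]

theorem IsSmoothForm.pullbackForm {φ : X → Y} (hφ : ContMDiff I I' ∞ φ)
    {B : ∀ y : Y, TangentSpace I' y →L[ℝ] TangentSpace I' y →L[ℝ] ℝ} (hB : IsSmoothForm B) :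
    IsSmoothForm (pullbackForm (I := I) φ B) := by
  refine isSmoothForm_iff_coordForm.2 fun x₀ ↦ ?_
  refine (contMDiffAt_bilinearComp_self
    ((isSmoothForm_iff_coordForm.1 hB (φ x₀)).comp x₀ hφ.contMDiffAt)
    ((hφ x₀).mfderiv_const (m := ∞) (by simp))).congr_of_eventuallyEq ?_
  have mem_baseSet : ∀ᶠ x in 𝓝 x₀,
      φ x ∈ (trivializationAt V' (TangentSpace I') (φ x₀)).baseSet :=
    hφ.continuous.continuousAt
      ((trivializationAt V' (TangentSpace I') (φ x₀)).open_baseSet.mem_nhds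
        (FiberBundle.mem_baseSet_trivializationAt' (φ x₀)))
  filter_upwards [mem_baseSet] with x hx using coordForm_pullbackForm φ B hx

end SmoothForms

section LeviSection

variable {V : Type*} [NormedAddCommGroup V] [NormedSpace ℂ V] {H : Type*} [TopologicalSpace H]
  (I : ModelWithCorners ℝ V H) {X : Type*} [TopologicalSpace X] [ChartedSpace H X]

/-- The Levi form of `f` on the tangent space at `x`, computed in the preferred chart at `x`. -/
def leviFormAt (f : X → ℝ) (x : X) : TangentSpace I x →L[ℝ] TangentSpace I x →L[ℝ] ℝ :=
  (leviForm (f ∘ (extChartAt I x).symm) (extChartAt I x x) : V →L[ℝ] V →L[ℝ] ℝ)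

/-- The transition maps between the preferred charts are holomorphic, to the order needed for the
Levi form to be independent of the chart. -/
def HasHolomorphicCharts (X : Type*) [TopologicalSpace X] [ChartedSpace H X] : Prop :=
  ∀ x₀ x z : X, z ∈ (extChartAt I x₀).source → z ∈ (extChartAt I x).source →
    ContDiffAt ℂ 2 (extChartAt I x ∘ (extChartAt I x₀).symm) (extChartAt I x₀ z)

variable {I}

theorem J_J (x : X) (u : TangentSpace I x) : J I x (J I x u) = -u := by
  change Complex.I • Complex.I • (show V from u) = -(show V from u)
  rw [smul_smul, Complex.I_mul_I, neg_smul, one_smul]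

theorem iddbar_eq_leviFormAt (f : X → ℝ) (x : X) (u v : TangentSpace I x) :
    iddbar I f x u v = leviFormAt I f x (J I x u) v := by
  have hJJ : Complex.I • (show V from J I x u) = -(show V from u) := J_J x u
  refine Eq.trans ?_ (leviForm_apply (V := V) _ _ _ _).symm
  rw [hJJ, map_neg, neg_apply, ← sub_eq_add_neg]
  rfl

theorem comp_extChartAt_symm_eventuallyEq (f : X → ℝ) {x₀ x : X}
    (hx : x ∈ (extChartAt I x₀).source) :
    f ∘ (extChartAt I x₀).symm =ᶠ[𝓝 (extChartAt I x₀ x)]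
      (f ∘ (extChartAt I x).symm) ∘ extChartAt I x ∘ (extChartAt I x₀).symm := by
  have source_mem : (extChartAt I x).source ∈ 𝓝 ((extChartAt I x₀).symm (extChartAt I x₀ x)) := by
    rw [(extChartAt I x₀).left_inv hx]
    exact extChartAt_source_mem_nhds x
  filter_upwards [(continuousAt_extChartAt_symm' hx).preimage_mem_nhds source_mem] with y hy
  exact congrArg f ((extChartAt I x).left_inv hy).symm

variable [I.Boundaryless] [IsManifold I ∞ X]

theorem contDiffAt_comp_extChartAt_symm {f : X → ℝ} (hf : ContMDiff I 𝓘(ℝ, ℝ) ∞ f) {x₀ z : X}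
    (hz : z ∈ (extChartAt I x₀).source) :
    ContDiffAt ℝ ∞ (f ∘ (extChartAt I x₀).symm) (extChartAt I x₀ z) :=
  (hf.contMDiffAt.comp _ ((contMDiffOn_extChartAt_symm x₀).contMDiffAt
    (extChartAt_target_mem_nhds' ((extChartAt I x₀).map_source hz)))).contDiffAt

theorem tangentCoordChange_eq_fderiv (hX : HasHolomorphicCharts I X) {x₀ x : X}
    (hx : x ∈ (extChartAt I x₀).source) :
    tangentCoordChange I x₀ x x =
      (fderiv ℂ (extChartAt I x ∘ (extChartAt I x₀).symm) (extChartAt I x₀ x)).restrictScalars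
        ℝ := by
  rw [tangentCoordChange_def, I.range_eq_univ, fderivWithin_univ]
  exact (((hX x₀ x x hx (mem_extChartAt_source x)).differentiableAt
    two_ne_zero).hasFDerivAt.restrictScalars ℝ).fderiv

theorem coordForm_leviFormAt (hX : HasHolomorphicCharts I X) {f : X → ℝ}
    (hf : ContMDiff I 𝓘(ℝ, ℝ) ∞ f) {x₀ x : X} (hx : x ∈ (extChartAt I x₀).source) :
    coordForm (leviFormAt I f) x₀ x =
      leviForm (f ∘ (extChartAt I x₀).symm) (extChartAt I x₀ x) := by
  have transition_apply :
      (extChartAt I x ∘ (extChartAt I x₀).symm) (extChartAt I x₀ x) = extChartAt I x x :=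
    congrArg (extChartAt I x) ((extChartAt I x₀).left_inv hx)
  have hfx : ContDiffAt ℝ 2 (f ∘ (extChartAt I x).symm)
      ((extChartAt I x ∘ (extChartAt I x₀).symm) (extChartAt I x₀ x)) := by
    rw [transition_apply]
    exact (contDiffAt_comp_extChartAt_symm hf (mem_extChartAt_source x)).of_le ENat.LEInfty.out
  have symmL_eq : (trivializationAt V (TangentSpace I) x₀).symmL ℝ x =
      (fderiv ℂ (extChartAt I x ∘ (extChartAt I x₀).symm) (extChartAt I x₀ x)).restrictScalars ℝ :=
    (TangentBundle.symmL_trivializationAt_eq_core (by rwa [← extChartAt_source I])).trans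
      (tangentCoordChange_eq_fderiv hX hx)
  ext u v
  rw [leviForm_congr (comp_extChartAt_symm_eventuallyEq f hx),
    leviForm_comp hfx (hX x₀ x x hx (mem_extChartAt_source x)), transition_apply, coordForm_apply,
    symmL_eq]
  rfl

theorem isSmoothForm_leviFormAt (hX : HasHolomorphicCharts I X) {f : X → ℝ}
    (hf : ContMDiff I 𝓘(ℝ, ℝ) ∞ f) : IsSmoothForm (leviFormAt I f) := by
  refine isSmoothForm_iff_coordForm.2 fun x₀ ↦ ?_
  have hlevi : ContMDiffAt I 𝓘(ℝ, V →L[ℝ] V →L[ℝ] ℝ) ∞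
      (fun x ↦ leviForm (f ∘ (extChartAt I x₀).symm) (extChartAt I x₀ x)) x₀ :=
    (contDiffAt_leviForm (contDiffAt_comp_extChartAt_symm hf
      (mem_extChartAt_source x₀))).contMDiffAt.comp x₀ contMDiffAt_extChartAt
  refine hlevi.congr_of_eventuallyEq ?_
  filter_upwards [extChartAt_source_mem_nhds (I := I) x₀] with x hx
    using coordForm_leviFormAt hX hf hx

end LeviSection

section LocalFrame

variable {E : Type*} [NormedAddCommGroup E] [NormedSpace ℂ E]
  {M : Type*} [TopologicalSpace M] [ChartedSpace E M]
  (L : M → Type*) [∀ x, AddCommGroup (L x)] [∀ x, TopologicalSpace (L x)]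
  [TopologicalSpace (Bundle.TotalSpace ℂ L)] [FiberBundle ℂ L]

/-- The holomorphic frame `e` given by the preferred trivialization of the line bundle `L` around
`x`; thus `h.localWeight x z` is `|e(z)|_h²`. -/
def localFrame (x z : M) : L z := (trivializationAt ℂ L x).symm z 1

variable {L}

theorem contMDiffAt_localFrame (x : M) :
    ContMDiffAt 𝓘(ℝ, E) (𝓘(ℝ, E).prod 𝓘(ℝ, ℂ)) ∞
      (fun z ↦ (⟨z, localFrame L x z⟩ : Bundle.TotalSpace ℂ L)) x := by
  refine Bundle.contMDiffAt_totalSpace.2 ⟨contMDiffAt_id, ?_⟩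
  refine (contMDiffAt_const (c := (1 : ℂ))).congr_of_eventuallyEq ?_
  filter_upwards [(trivializationAt ℂ L x).open_baseSet.mem_nhds
    (FiberBundle.mem_baseSet_trivializationAt' x)] with z hz
  exact congrArg Prod.snd ((trivializationAt ℂ L x).apply_mk_symm hz (1 : ℂ))

variable [∀ x, Module ℂ (L x)] [VectorBundle ℂ ℂ L]

theorem localFrame_ne_zero {x z : M} (hz : z ∈ (trivializationAt ℂ L x).baseSet) :
    localFrame L x z ≠ 0 :=
  (((trivializationAt ℂ L x).continuousLinearEquivAt ℂ z hz).symm.map_ne_zero_iff).2 one_ne_zero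

theorem exists_eq_smul_localFrame {x z : M} (hz : z ∈ (trivializationAt ℂ L x).baseSet)
    (t : L z) : ∃ c : ℂ, t = c • localFrame L x z := by
  let e := (trivializationAt ℂ L x).continuousLinearEquivAt ℂ z hz
  have frame_eq : localFrame L x z = e.symm 1 := rfl
  exact ⟨e t, by rw [frame_eq, ← map_smul, smul_eq_mul, mul_one, e.symm_apply_apply]⟩

namespace HermitianMetric

variable (h : HermitianMetric E L)

/-- The local weight `|e|_h²` read in the preferred chart of the base around `x`. -/
def chartWeight (x : M) (z : E) : ℝ := h.localWeight x ((extChartAt 𝓘(ℝ, E) x).symm z)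

theorem localWeight_pos {x z : M} (hz : z ∈ (trivializationAt ℂ L x).baseSet) :
    0 < h.localWeight x z :=
  h.pos z _ (localFrame_ne_zero hz)

theorem dualNormSq_eq_div_localWeight {x : M} {v : DualTotal L}
    (hv : v.1 ∈ (trivializationAt ℂ L x).baseSet) :
    h.dualNormSq v = ‖(v.2 (localFrame L x v.1) : ℂ)‖ ^ 2 / h.localWeight x v.1 :=
  h.dualNormSq_eq_of_frame v _ (localFrame_ne_zero hv) (exists_eq_smul_localFrame hv)

omit [VectorBundle ℂ ℂ L] in
theorem contMDiffAt_localWeight (x : M) : ContMDiffAt 𝓘(ℝ, E) 𝓘(ℝ, ℝ) ∞ (h.localWeight x) x :=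
  h.smooth.contMDiffAt.comp x (contMDiffAt_localFrame x)

omit [VectorBundle ℂ ℂ L] in
theorem contDiffAt_chartWeight [IsManifold 𝓘(ℂ, E) ω M] (x : M) :
    ContDiffAt ℝ ∞ (h.chartWeight x) (extChartAt 𝓘(ℝ, E) x x) := by
  have chart_symm : ContMDiffAt 𝓘(ℝ, E) 𝓘(ℝ, E) ∞ (extChartAt 𝓘(ℝ, E) x).symm
      (extChartAt 𝓘(ℝ, E) x x) :=
    (contMDiffOn_extChartAt_symm x).contMDiffAt (extChartAt_target_mem_nhds x)
  exact (ContMDiffAt.comp_of_eq (h.contMDiffAt_localWeight x) chart_symm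
    ((extChartAt 𝓘(ℝ, E) x).left_inv (mem_extChartAt_source x))).contDiffAt

theorem contDiffAt_log_chartWeight [IsManifold 𝓘(ℂ, E) ω M] (x : M) :
    ContDiffAt ℝ ∞ (fun z ↦ Real.log (h.chartWeight x z)) (extChartAt 𝓘(ℝ, E) x x) := by
  refine (h.contDiffAt_chartWeight x).log ?_
  rw [chartWeight, (extChartAt 𝓘(ℝ, E) x).left_inv (mem_extChartAt_source x)]
  exact (h.localWeight_pos (FiberBundle.mem_baseSet_trivializationAt' x)).ne'

end HermitianMetric

end LocalFrame

section DiscCharts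

/-- Evaluation at `1`, the linear coordinate on the dual of `ℂ`. -/
def evalOne : (ℂ →L[ℂ] ℂ) →L[ℂ] ℂ := ContinuousLinearMap.apply ℂ ℂ 1

theorem isometry_evalOne : Isometry evalOne :=
  (ContinuousLinearMap.toSpanSingletonLIE ℂ ℂ).symm.isometry

variable {E : Type*} [NormedAddCommGroup E] [NormedSpace ℂ E]
  {M : Type*} [TopologicalSpace M] [ChartedSpace E M]
  {L : M → Type*} [∀ x, AddCommGroup (L x)] [∀ x, Module ℂ (L x)]
  [∀ x, TopologicalSpace (L x)] [TopologicalSpace (Bundle.TotalSpace ℂ L)]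
  [FiberBundle ℂ L] [VectorBundle ℂ ℂ L] {h : HermitianMetric E L}

variable (L) in
/-- The preferred trivialization of `L^*` around `x`. -/
abbrev dualTrivializationAt (x : M) :=
  trivializationAt (ℂ →L[ℂ] ℂ) (fun x : M ↦ L x →L[ℂ] Bundle.Trivial M ℂ x) x

theorem evalOne_dualTrivializationAt_snd {x : M} {v : DualTotal L}
    (hv : v.1 ∈ (trivializationAt ℂ L x).baseSet) :
    evalOne (dualTrivializationAt L x v).2 = v.2 (localFrame L x v.1) := by
  have evalOne_eq : evalOne (dualTrivializationAt L x v).2 =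
      (Bundle.Trivial.trivialization M ℂ).continuousLinearMapAt ℂ v.1
        (v.2 ((trivializationAt ℂ L x).symmL ℂ v.1 1)) := rfl
  rw [evalOne_eq, Bundle.Trivial.continuousLinearMapAt_trivialization]
  exact congrArg v.2 ((trivializationAt ℂ L x).symmL_apply (R := ℂ) hv (1 : ℂ))

theorem norm_dualTrivializationAt_snd_sq_lt {x : M} {q : discBundle h}
    (hq : discProj h q ∈ (trivializationAt ℂ L x).baseSet) :
    ‖(dualTrivializationAt L x q.1).2‖ ^ 2 < h.localWeight x (discProj h q) := by
  rw [← isometry_evalOne.norm_map_of_map_zero (map_zero _), evalOne_dualTrivializationAt_snd hq,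
    ← div_lt_one (h.localWeight_pos hq)]
  exact (h.dualNormSq_eq_div_localWeight hq).symm.trans_lt q.2

theorem extChartAt_disc_fst (p q : discBundle h) :
    (extChartAt (totalModel E) p q).1 = extChartAt 𝓘(ℝ, E) (discProj h p) (discProj h q) :=
  rfl

theorem mem_extChartAt_disc_source {p q : discBundle h} :
    q ∈ (extChartAt (totalModel E) p).source ↔
      discProj h q ∈ (extChartAt 𝓘(ℝ, E) (discProj h p)).source ∧
        discProj h q ∈ (trivializationAt ℂ L (discProj h p)).baseSet := by
  have mem_iff_mem_chartAt_source : q ∈ (extChartAt (totalModel E) p).source ↔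
      q.1 ∈ (chartAt (ModelProd E (ℂ →L[ℂ] ℂ)) p.1).source := by
    rw [extChartAt_source, TopologicalSpace.Opens.chartAt_eq,
      OpenPartialHomeomorph.subtypeRestr_source]
    rfl
  rw [mem_iff_mem_chartAt_source, FiberBundle.chartedSpace_chartAt, extChartAt_source,
    OpenPartialHomeomorph.trans_source]
  simp only [hom_trivializationAt_source, Bundle.Trivial.fiberBundle_trivializationAt',
    Bundle.Trivial.trivialization_baseSet, Set.inter_univ, OpenPartialHomeomorph.prod_source,
    OpenPartialHomeomorph.refl_source, Set.mem_inter_iff, Set.mem_preimage, Set.mem_prod,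
    Set.mem_univ, and_true]
  exact and_comm

theorem chartWeight_extChartAt_fst {p q : discBundle h}
    (hq : q ∈ (extChartAt (totalModel E) p).source) :
    h.chartWeight (discProj h p) (extChartAt (totalModel E) p q).1 =
      h.localWeight (discProj h p) (discProj h q) := by
  rw [HermitianMetric.chartWeight, extChartAt_disc_fst,
    (extChartAt 𝓘(ℝ, E) _).left_inv (mem_extChartAt_disc_source.1 hq).1]

theorem chartWeight_extChartAt_fst_pos {p q : discBundle h}
    (hq : q ∈ (extChartAt (totalModel E) p).source) :
    0 < h.chartWeight (discProj h p) (extChartAt (totalModel E) p q).1 := by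
  rw [chartWeight_extChartAt_fst hq]
  exact h.localWeight_pos (mem_extChartAt_disc_source.1 hq).2

theorem dualNormSq_eq_div_chartWeight {p q : discBundle h}
    (hq : q ∈ (extChartAt (totalModel E) p).source) :
    h.dualNormSq q.1 = ‖evalOne (extChartAt (totalModel E) p q).2‖ ^ 2 /
      h.chartWeight (discProj h p) (extChartAt (totalModel E) p q).1 := by
  have hb := (mem_extChartAt_disc_source.1 hq).2
  rw [chartWeight_extChartAt_fst hq, h.dualNormSq_eq_div_localWeight hb,
    ← evalOne_dualTrivializationAt_snd hb]
  rfl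

theorem discPotential_extChartAt {p q : discBundle h}
    (hq : q ∈ (extChartAt (totalModel E) p).source) :
    discPotential (h.chartWeight (discProj h p)) evalOne (extChartAt (totalModel E) p q) =
      h.chartWeight (discProj h p) (extChartAt (totalModel E) p q).1 *
        (1 - h.dualNormSq q.1) := by
  have := chartWeight_extChartAt_fst_pos hq
  rw [discPotential, dualNormSq_eq_div_chartWeight hq]
  field_simp

theorem discPotential_extChartAt_pos {p q : discBundle h}
    (hq : q ∈ (extChartAt (totalModel E) p).source) :
    0 < discPotential (h.chartWeight (discProj h p)) evalOne (extChartAt (totalModel E) p q) := by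
  rw [discPotential_extChartAt hq]
  exact mul_pos (chartWeight_extChartAt_fst_pos hq) (sub_pos.2 q.2)

variable (h)

/-- The function `log (1 - |v|²)` on the disc bundle. -/
def logDefect (q : discBundle h) : ℝ := Real.log (1 - h.dualNormSq q.1)

/-- The function `log (1 - |w|² / H)` in the chart around a point over `x`, where `w` is the fibre
coordinate and `H` the weight of `h`. -/
def chartLogDefect (x : M) (y : E × (ℂ →L[ℂ] ℂ)) : ℝ :=
  Real.log (discPotential (h.chartWeight x) evalOne y) - Real.log (h.chartWeight x y.1)

variable {h} in
theorem logDefect_eq_chartLogDefect {p q : discBundle h}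
    (hq : q ∈ (extChartAt (totalModel E) p).source) :
    logDefect h q = chartLogDefect h (discProj h p) (extChartAt (totalModel E) p q) := by
  rw [chartLogDefect, discPotential_extChartAt hq,
    Real.log_mul (chartWeight_extChartAt_fst_pos hq).ne' (sub_pos.2 q.2).ne',
    add_sub_cancel_left, logDefect]

theorem logDefect_comp_extChartAt_symm_eventuallyEq (p : discBundle h) :
    logDefect h ∘ (extChartAt (totalModel E) p).symm =ᶠ[𝓝 (extChartAt (totalModel E) p p)]
      chartLogDefect h (discProj h p) := by
  filter_upwards [extChartAt_target_mem_nhds (I := totalModel E) p] with y hy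
  rw [Function.comp_apply,
    logDefect_eq_chartLogDefect ((extChartAt (totalModel E) p).map_target hy),
    (extChartAt (totalModel E) p).right_inv hy]

theorem continuous_discProj : Continuous (discProj h) :=
  (FiberBundle.continuous_proj (ℂ →L[ℂ] ℂ)
    (fun x : M ↦ L x →L[ℂ] Bundle.Trivial M ℂ x)).comp continuous_subtype_val

theorem writtenInExtChartAt_discProj_eventuallyEq (p : discBundle h) :
    writtenInExtChartAt (totalModel E) 𝓘(ℝ, E) p (discProj h)
      =ᶠ[𝓝 (extChartAt (totalModel E) p p)] Prod.fst := by
  filter_upwards [extChartAt_target_mem_nhds (I := totalModel E) p] with y hy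
  rw [writtenInExtChartAt, Function.comp_apply, Function.comp_apply, ← extChartAt_disc_fst,
    (extChartAt (totalModel E) p).right_inv hy]

theorem contMDiff_discProj : ContMDiff (totalModel E) 𝓘(ℝ, E) ∞ (discProj h) :=
  fun p ↦ contMDiffAt_iff.2 ⟨(continuous_discProj h).continuousAt,
    (contDiffAt_fst.congr_of_eventuallyEq
      (writtenInExtChartAt_discProj_eventuallyEq h p)).contDiffWithinAt⟩

theorem mfderiv_discProj (p : discBundle h) (u : TangentSpace (totalModel E) p) :
    mfderiv (totalModel E) 𝓘(ℝ, E) (discProj h) p u = (show E × (ℂ →L[ℂ] ℂ) from u).1 := by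
  have hasMFDerivAt_fst : HasMFDerivAt (totalModel E) 𝓘(ℝ, E) (discProj h) p
      (ContinuousLinearMap.fst ℝ E (ℂ →L[ℂ] ℂ)) :=
    ⟨(continuous_discProj h).continuousAt, (hasFDerivAt_fst.congr_of_eventuallyEq
      (writtenInExtChartAt_discProj_eventuallyEq h p)).hasFDerivWithinAt⟩
  rw [hasMFDerivAt_fst.mfderiv]
  rfl

variable [IsManifold 𝓘(ℂ, E) ω M]

theorem contDiffAt_log_discPotential_extChartAt (p : discBundle h) :
    ContDiffAt ℝ ∞ (fun y ↦ Real.log (discPotential (h.chartWeight (discProj h p)) evalOne y))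
      (extChartAt (totalModel E) p p) :=
  (contDiffAt_discPotential (h.contDiffAt_chartWeight (discProj h p))).log
    (discPotential_extChartAt_pos (mem_extChartAt_source p)).ne'

theorem contDiffAt_log_chartWeight_fst (p : discBundle h) :
    ContDiffAt ℝ ∞ (fun y : E × (ℂ →L[ℂ] ℂ) ↦ Real.log (h.chartWeight (discProj h p) y.1))
      (extChartAt (totalModel E) p p) :=
  ContDiffAt.comp (g := fun z ↦ Real.log (h.chartWeight (discProj h p) z)) _
    (h.contDiffAt_log_chartWeight (discProj h p)) contDiffAt_fst

theorem contDiffAt_chartLogDefect (p : discBundle h) :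
    ContDiffAt ℝ ∞ (chartLogDefect h (discProj h p)) (extChartAt (totalModel E) p p) :=
  (contDiffAt_log_discPotential_extChartAt h p).sub (contDiffAt_log_chartWeight_fst h p)

theorem contMDiff_logDefect : ContMDiff (totalModel E) 𝓘(ℝ, ℝ) ∞ (logDefect h) := by
  intro p
  refine ((contDiffAt_chartLogDefect h p).contMDiffAt.comp p
    contMDiffAt_extChartAt).congr_of_eventuallyEq ?_
  filter_upwards [extChartAt_source_mem_nhds (I := totalModel E) p] with q hq
  exact logDefect_eq_chartLogDefect hq

variable [ContMDiffVectorBundle ω ℂ L 𝓘(ℂ, E)]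

theorem hasHolomorphicCharts_discBundle : HasHolomorphicCharts (totalModel E) (discBundle h) := by
  intro x₀ x z hx₀ hx
  have mem_source : extChartAt (totalModel E) x₀ z ∈
      ((extChartAt (totalModel E) x₀).symm.trans (extChartAt (totalModel E) x)).source := by
    refine ⟨(extChartAt (totalModel E) x₀).map_source hx₀, ?_⟩
    change (extChartAt (totalModel E) x₀).symm (extChartAt (totalModel E) x₀ z) ∈
      (extChartAt (totalModel E) x).source
    rwa [(extChartAt (totalModel E) x₀).left_inv hx₀]
  have coord_change := contDiffWithinAt_ext_coord_change
    (I := 𝓘(ℂ, E).prod 𝓘(ℂ, ℂ →L[ℂ] ℂ)) (n := ω) x x₀ mem_source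
  rw [ModelWithCorners.Boundaryless.range_eq_univ, contDiffWithinAt_univ] at coord_change
  exact coord_change.of_le le_top

end DiscCharts

section DiscMetric

theorem isBounded_inner_lt_one {V : Type*} [NormedAddCommGroup V] [NormedSpace ℝ V] {H : Type*}
    [TopologicalSpace H] {I : ModelWithCorners ℝ V H} {X : Type*} [TopologicalSpace X]
    [ChartedSpace H X] [IsManifold I ∞ X]
    (g : Bundle.ContMDiffRiemannianMetric I ∞ V (fun x : X ↦ TangentSpace I x)) (x : X) :
    Bornology.IsBounded {v : V | g.inner x v v < 1} :=
  (NormedSpace.isVonNBounded_iff ℝ (E := V)).1 (g.isVonNBounded x)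

theorem inner_self_nonneg {V : Type*} [NormedAddCommGroup V] [NormedSpace ℝ V] {H : Type*}
    [TopologicalSpace H] {I : ModelWithCorners ℝ V H} {X : Type*} [TopologicalSpace X]
    [ChartedSpace H X] [IsManifold I ∞ X]
    (g : Bundle.ContMDiffRiemannianMetric I ∞ V (fun x : X ↦ TangentSpace I x)) (x : X)
    (v : TangentSpace I x) : 0 ≤ g.inner x v v := by
  rcases eq_or_ne v 0 with rfl | hv
  · exact (map_zero _).ge
  · exact (g.pos x v hv).le

variable {E : Type*} [NormedAddCommGroup E] [NormedSpace ℂ E]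
  {M : Type*} [TopologicalSpace M] [ChartedSpace E M] [IsManifold 𝓘(ℂ, E) ω M]
  {L : M → Type*} [∀ x, AddCommGroup (L x)] [∀ x, Module ℂ (L x)]
  [∀ x, TopologicalSpace (L x)] [TopologicalSpace (Bundle.TotalSpace ℂ L)]
  [FiberBundle ℂ L] [VectorBundle ℂ ℂ L] {h : HermitianMetric E L}
  {gM : Bundle.ContMDiffRiemannianMetric 𝓘(ℝ, E) ∞ E (fun x : M ↦ TangentSpace 𝓘(ℝ, E) x)}

omit [VectorBundle ℂ ℂ L] in
theorem inner_eq_neg_leviForm_log_chartWeight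
    (hM : IsHermitianWithForm 𝓘(ℝ, E) gM h.curvatureForm) (x : M) (u v : E) :
    gM.inner x u v =
      -leviForm (fun z ↦ Real.log (h.chartWeight x z)) (extChartAt 𝓘(ℝ, E) x x) u v := by
  have inner_eq_neg_leviFormAt (u v : TangentSpace 𝓘(ℝ, E) x) : gM.inner x u v =
      -leviFormAt 𝓘(ℝ, E) (fun z ↦ Real.log (h.localWeight x z)) x u v := by
    have inner_JJ := (hM x (J 𝓘(ℝ, E) x u) v).2
    rw [HermitianMetric.curvatureForm, iddbar_eq_leviFormAt] at inner_JJ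
    simp only [J_J, map_neg, neg_apply, neg_neg] at inner_JJ
    exact neg_eq_iff_eq_neg.1 inner_JJ.symm
  exact inner_eq_neg_leviFormAt u v

variable (h gM) in
/-- The bilinear form `g_D(u, v) = ω_D(u, Jv)` on the tangent spaces of the disc bundle, namely
`π^* g_M` minus the Levi form of `log (1 - |v|²)`. -/
def discInner (p : discBundle h) :
    TangentSpace (totalModel E) p →L[ℝ] TangentSpace (totalModel E) p →L[ℝ] ℝ :=
  pullbackForm (I := totalModel E) (discProj h) gM.inner p -
    leviFormAt (totalModel E) (logDefect h) p

/-- In a chart, the pullback of `-log H` to the total space cancels the term `-log H` of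
`log (1 - |v|²) = log (H - |w|²) - log H`. -/
theorem discInner_eq_neg_leviForm (hM : IsHermitianWithForm 𝓘(ℝ, E) gM h.curvatureForm)
    (p : discBundle h) (u v : E × (ℂ →L[ℂ] ℂ)) :
    discInner h gM p u v =
      -leviForm (fun y ↦ Real.log (discPotential (h.chartWeight (discProj h p)) evalOne y))
        (extChartAt (totalModel E) p p) u v := by
  have pullback_eq : pullbackForm (I := totalModel E) (discProj h) gM.inner p u v =
      -leviForm (fun y : E × (ℂ →L[ℂ] ℂ) ↦ Real.log (h.chartWeight (discProj h p) y.1))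
        (extChartAt (totalModel E) p p) u v := by
    calc pullbackForm (I := totalModel E) (discProj h) gM.inner p u v
        = gM.inner (discProj h p) u.1 v.1 :=
          congrArg₂ (fun a b : E ↦ gM.inner (discProj h p) a b) (mfderiv_discProj h p u)
            (mfderiv_discProj h p v)
      _ = _ := inner_eq_neg_leviForm_log_chartWeight hM _ _ _
      _ = _ := congrArg Neg.neg (leviForm_comp_fst (y := extChartAt (totalModel E) p p)
          ((h.contDiffAt_log_chartWeight (discProj h p)).of_le ENat.LEInfty.out) u v).symm
  have leviFormAt_eq : leviFormAt (totalModel E) (logDefect h) p u v =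
      leviForm (chartLogDefect h (discProj h p)) (extChartAt (totalModel E) p p) u v :=
    congrArg (fun B : E × (ℂ →L[ℂ] ℂ) →L[ℝ] E × (ℂ →L[ℂ] ℂ) →L[ℝ] ℝ ↦ B u v)
      (leviForm_congr (logDefect_comp_extChartAt_symm_eventuallyEq h p))
  have levi_sub := leviForm_sub
    ((contDiffAt_log_discPotential_extChartAt h p).of_le ENat.LEInfty.out)
    ((contDiffAt_log_chartWeight_fst h p).of_le ENat.LEInfty.out) u v
  calc discInner h gM p u v
      = pullbackForm (I := totalModel E) (discProj h) gM.inner p u v -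
          leviFormAt (totalModel E) (logDefect h) p u v := rfl
    _ = _ := by
      rw [pullback_eq, leviFormAt_eq]
      unfold chartLogDefect
      rw [levi_sub]
      ring

theorem contDiffAt_two_chartWeight (p : discBundle h) :
    ContDiffAt ℝ 2 (h.chartWeight (discProj h p)) (extChartAt (totalModel E) p p).1 :=
  (h.contDiffAt_chartWeight (discProj h p)).of_le ENat.LEInfty.out

theorem neg_leviForm_log_chartWeight_nonneg
    (hM : IsHermitianWithForm 𝓘(ℝ, E) gM h.curvatureForm) (p : discBundle h) (v : E) :
    0 ≤ -leviForm (fun z ↦ Real.log (h.chartWeight (discProj h p) z))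
      (extChartAt (totalModel E) p p).1 v v :=
  (inner_self_nonneg gM (discProj h p) v).trans_eq
    (inner_eq_neg_leviForm_log_chartWeight hM _ v v)

theorem discInner_pos (hM : IsHermitianWithForm 𝓘(ℝ, E) gM h.curvatureForm) (p : discBundle h)
    {u : E × (ℂ →L[ℂ] ℂ)} (hu : u ≠ 0) : 0 < discInner h gM p u u := by
  rw [discInner_eq_neg_leviForm hM]
  exact neg_leviForm_log_discPotential_pos isometry_evalOne.injective (contDiffAt_two_chartWeight p)
    (chartWeight_extChartAt_fst_pos (mem_extChartAt_source p))
    (discPotential_extChartAt_pos (mem_extChartAt_source p))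
    (fun v hv ↦ (gM.pos (discProj h p) v hv).trans_eq
      (inner_eq_neg_leviForm_log_chartWeight hM _ v v)) hu

theorem isBounded_discInner_lt_one (hM : IsHermitianWithForm 𝓘(ℝ, E) gM h.curvatureForm)
    (p : discBundle h) :
    Bornology.IsBounded {u : E × (ℂ →L[ℂ] ℂ) | discInner h gM p u u < 1} := by
  have base_bounded := isBounded_inner_lt_one gM (discProj h p)
  simp only [inner_eq_neg_leviForm_log_chartWeight hM] at base_bounded
  simp only [discInner_eq_neg_leviForm hM]
  exact isBounded_neg_leviForm_log_discPotential isometry_evalOne.antilipschitz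
    (contDiffAt_two_chartWeight p) (chartWeight_extChartAt_fst_pos (mem_extChartAt_source p))
    (discPotential_extChartAt_pos (mem_extChartAt_source p))
    (neg_leviForm_log_chartWeight_nonneg hM p) base_bounded

theorem inner_mfderiv_discProj_le_discInner
    (hM : IsHermitianWithForm 𝓘(ℝ, E) gM h.curvatureForm) (p : discBundle h)
    (u : TangentSpace (totalModel E) p) :
    gM.inner (discProj h p) (mfderiv (totalModel E) 𝓘(ℝ, E) (discProj h) p u)
      (mfderiv (totalModel E) 𝓘(ℝ, E) (discProj h) p u) ≤ discInner h gM p u u := by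
  rw [mfderiv_discProj]
  exact (inner_eq_neg_leviForm_log_chartWeight hM _ _ _).trans_le <|
    (neg_leviForm_log_weight_le (contDiffAt_two_chartWeight p)
      (chartWeight_extChartAt_fst_pos (mem_extChartAt_source p))
      (discPotential_extChartAt_pos (mem_extChartAt_source p)) u
      (neg_leviForm_log_chartWeight_nonneg hM p _)).trans_eq
    (discInner_eq_neg_leviForm hM p u u).symm

theorem mfderiv_logDefect_sq_le (hM : IsHermitianWithForm 𝓘(ℝ, E) gM h.curvatureForm)
    (p : discBundle h) (u : TangentSpace (totalModel E) p) :
    (show ℝ from mfderiv (totalModel E) 𝓘(ℝ, ℝ) (logDefect h) p u) ^ 2 ≤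
      2 * discInner h gM p u u := by
  have mfderiv_eq : mfderiv (totalModel E) 𝓘(ℝ, ℝ) (logDefect h) p =
      fderiv ℝ (chartLogDefect h (discProj h p)) (extChartAt (totalModel E) p p) := by
    rw [((contMDiff_logDefect h).mdifferentiable (by simp) p).mfderiv,
      ModelWithCorners.Boundaryless.range_eq_univ, fderivWithin_univ]
    exact (logDefect_comp_extChartAt_symm_eventuallyEq h p).fderiv_eq
  rw [mfderiv_eq]
  exact (fderiv_log_sub_log_discPotential_sq_le (contDiffAt_two_chartWeight p)
      (chartWeight_extChartAt_fst_pos (mem_extChartAt_source p))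
      (discPotential_extChartAt_pos (mem_extChartAt_source p)) u
      (neg_leviForm_log_chartWeight_nonneg hM p _)).trans_eq
    (congrArg (2 * ·) (discInner_eq_neg_leviForm hM p u u).symm)

variable [ContMDiffVectorBundle ω ℂ L 𝓘(ℂ, E)]

/-- The metric `g_D` of the disc bundle. -/
def discMetric (hM : IsHermitianWithForm 𝓘(ℝ, E) gM h.curvatureForm) :
    Bundle.ContMDiffRiemannianMetric (totalModel E) ∞ (E × (ℂ →L[ℂ] ℂ))
      (fun p : discBundle h ↦ TangentSpace (totalModel E) p) where
  inner := discInner h gM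
  symm p u v := (discInner_eq_neg_leviForm hM p u v).trans <|
    (congrArg Neg.neg (leviForm_symm
      ((contDiffAt_log_discPotential_extChartAt h p).of_le ENat.LEInfty.out) u v)).trans
    (discInner_eq_neg_leviForm hM p v u).symm
  pos p _ hu := discInner_pos hM p hu
  isVonNBounded p := (NormedSpace.isVonNBounded_iff ℝ (E := E × (ℂ →L[ℂ] ℂ))).2
    (isBounded_discInner_lt_one hM p)
  contMDiff :=
    (IsSmoothForm.pullbackForm (contMDiff_discProj h) (B := gM.inner) gM.contMDiff).sub
      (isSmoothForm_leviFormAt (hasHolomorphicCharts_discBundle h) (contMDiff_logDefect h))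

theorem isHermitianWithForm_discMetric (hM : IsHermitianWithForm 𝓘(ℝ, E) gM h.curvatureForm) :
    IsHermitianWithForm (totalModel E) (discMetric hM) (discForm h) := by
  intro p u v
  have mfderiv_J : mfderiv (totalModel E) 𝓘(ℝ, E) (discProj h) p (J (totalModel E) p u) =
      J 𝓘(ℝ, E) (discProj h p) (mfderiv (totalModel E) 𝓘(ℝ, E) (discProj h) p u) := by
    rw [mfderiv_discProj, mfderiv_discProj]
    rfl
  constructor
  · refine (discInner_eq_neg_leviForm hM p _ _).trans
      (Eq.trans ?_ (discInner_eq_neg_leviForm hM p u v).symm)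
    exact congrArg Neg.neg (leviForm_I_smul _ _ _ _)
  · rw [discForm, iddbar_eq_leviFormAt, (hM _ _ _).2, ← mfderiv_J]
    rfl

end DiscMetric

section Lipschitz

open MeasureTheory Manifold
open scoped ENNReal NNReal

variable {V : Type*} [NormedAddCommGroup V] [NormedSpace ℝ V] {H : Type*} [TopologicalSpace H]
  {I : ModelWithCorners ℝ V H} {X : Type*} [TopologicalSpace X] [ChartedSpace H X]
  {V' : Type*} [NormedAddCommGroup V'] [NormedSpace ℝ V'] {H' : Type*} [TopologicalSpace H']
  {I' : ModelWithCorners ℝ V' H'} {Y : Type*} [TopologicalSpace Y] [ChartedSpace H' Y]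
  [∀ x : X, ENorm (TangentSpace I x)] [∀ y : Y, ENorm (TangentSpace I' y)]

/-- Points in different components are at distance `∞`, and `0 * ∞ = 0`. -/
theorem riemannianEDist_map_le_mul {f : X → Y} (hf : ContMDiff I I' 1 f) {C : ℝ≥0} (hC : C ≠ 0)
    (hle : ∀ (x : X) (v : TangentSpace I x), ‖mfderiv I I' f x v‖ₑ ≤ C * ‖v‖ₑ) (x y : X) :
    riemannianEDist I' (f x) (f y) ≤ C * riemannianEDist I x y := by
  rw [riemannianEDist_def I x y]
  simp_rw [ENNReal.mul_iInf_of_ne (ENNReal.coe_ne_zero.2 hC) ENNReal.coe_ne_top]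
  refine le_iInf₂ fun γ hγ ↦ ?_
  have mfderiv_map (t : unitInterval) : mfderiv (𝓡∂ 1) I' (γ.map hf.continuous) t =
      (mfderiv I I' f (γ t)).comp (mfderiv (𝓡∂ 1) I γ t) :=
    mfderiv_comp t (hf.mdifferentiable one_ne_zero _) (hγ.mdifferentiable one_ne_zero t)
  calc riemannianEDist I' (f x) (f y)
      ≤ ∫⁻ t, ‖mfderiv (𝓡∂ 1) I' (γ.map hf.continuous) t 1‖ₑ :=
        (riemannianEDist_def I' _ _).trans_le (iInf₂_le (γ.map hf.continuous) (hf.comp hγ))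
    _ ≤ ∫⁻ t, C * ‖mfderiv (𝓡∂ 1) I γ t 1‖ₑ := lintegral_mono fun t ↦ by
        rw [mfderiv_map]
        exact hle _ _
    _ = C * ∫⁻ t, ‖mfderiv (𝓡∂ 1) I γ t 1‖ₑ := lintegral_const_mul' _ _ ENNReal.coe_ne_top

end Lipschitz

section MetricDist

open Filter Manifold
open scoped ENNReal NNReal

variable {V : Type*} [NormedAddCommGroup V] [NormedSpace ℂ V]
  {H : Type*} [TopologicalSpace H] {I : ModelWithCorners ℝ V H}
  {X : Type*} [TopologicalSpace X] [ChartedSpace H X] [IsManifold I ∞ X]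
  {V' : Type*} [NormedAddCommGroup V'] [NormedSpace ℂ V']
  {H' : Type*} [TopologicalSpace H'] {I' : ModelWithCorners ℝ V' H'}
  {Y : Type*} [TopologicalSpace Y] [ChartedSpace H' Y] [IsManifold I' ∞ Y]
  (g : Bundle.ContMDiffRiemannianMetric I ∞ V (fun x : X ↦ TangentSpace I x))
  (g' : Bundle.ContMDiffRiemannianMetric I' ∞ V' (fun y : Y ↦ TangentSpace I' y))

/-- Cauchy sequences for the distance of a Riemannian metric, as in `IsCompleteMetric`. -/
def IsCauchy (a : ℕ → X) : Prop :=
  ∀ ε : ℝ≥0∞, 0 < ε → ∃ N, ∀ j ≥ N, ∀ k ≥ N, metricDist I g (a j) (a k) < ε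

theorem enorm_tangentSpace (x : X) (v : TangentSpace I x) :
    letI : Bundle.RiemannianBundle (fun x : X ↦ TangentSpace I x) := ⟨g.toRiemannianMetric⟩
    ‖v‖ₑ = ENNReal.ofReal √(g.inner x v v) := by
  let _ : Bundle.RiemannianBundle (fun x : X ↦ TangentSpace I x) := ⟨g.toRiemannianMetric⟩
  rw [← ofReal_norm, norm_eq_sqrt_real_inner]
  rfl

theorem isContinuousRiemannianBundle_tangentSpace :
    letI : Bundle.RiemannianBundle (fun x : X ↦ TangentSpace I x) := ⟨g.toRiemannianMetric⟩
    IsContinuousRiemannianBundle V (fun x : X ↦ TangentSpace I x) :=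
  letI : Bundle.RiemannianBundle (fun x : X ↦ TangentSpace I x) := ⟨g.toRiemannianMetric⟩
  ⟨⟨g.inner, g.contMDiff.continuous, fun _ _ _ ↦ rfl⟩⟩

theorem metricDist_comm (x y : X) : metricDist I g x y = metricDist I g y x :=
  letI : Bundle.RiemannianBundle (fun x : X ↦ TangentSpace I x) := ⟨g.toRiemannianMetric⟩
  riemannianEDist_comm

theorem metricDist_triangle (x y z : X) :
    metricDist I g x z ≤ metricDist I g x y + metricDist I g y z :=
  letI : Bundle.RiemannianBundle (fun x : X ↦ TangentSpace I x) := ⟨g.toRiemannianMetric⟩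
  riemannianEDist_triangle

theorem eventually_metricDist_lt (x : X) {c : ℝ≥0∞} (hc : 0 < c) :
    ∀ᶠ y in 𝓝 x, metricDist I g x y < c :=
  letI : Bundle.RiemannianBundle (fun x : X ↦ TangentSpace I x) := ⟨g.toRiemannianMetric⟩
  have := isContinuousRiemannianBundle_tangentSpace g
  eventually_riemannianEDist_lt I x hc

variable {g}

theorem tendsto_of_tendsto_metricDist [RegularSpace X] {a : ℕ → X} {x : X}
    (ha : Tendsto (fun j ↦ metricDist I g (a j) x) atTop (𝓝 0)) : Tendsto a atTop (𝓝 x) :=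
  letI : Bundle.RiemannianBundle (fun x : X ↦ TangentSpace I x) := ⟨g.toRiemannianMetric⟩
  have := isContinuousRiemannianBundle_tangentSpace g
  letI : PseudoEMetricSpace X := .ofRiemannianMetric I X
  tendsto_iff_edist_tendsto_0.2 ha

theorem IsCauchy.tendsto_metricDist_of_subseq {a : ℕ → X} (ha : IsCauchy g a) {φ : ℕ → ℕ}
    (hφ : StrictMono φ) {x : X} (hx : Tendsto (a ∘ φ) atTop (𝓝 x)) :
    Tendsto (fun j ↦ metricDist I g (a j) x) atTop (𝓝 0) := by
  rw [ENNReal.tendsto_nhds_zero]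
  intro ε hε
  obtain ⟨N, hN⟩ := ha (ε / 2) (ENNReal.half_pos hε.ne')
  obtain ⟨k, dist_lt, hk⟩ := ((hx.eventually (eventually_metricDist_lt g x
    (ENNReal.half_pos hε.ne'))).and (hφ.tendsto_atTop.eventually_ge_atTop N)).exists
  filter_upwards [eventually_ge_atTop N] with j hj
  calc metricDist I g (a j) x
      ≤ metricDist I g (a j) (a (φ k)) + metricDist I g (a (φ k)) x := metricDist_triangle g _ _ _
    _ ≤ ε / 2 + ε / 2 :=
      add_le_add (hN j hj _ hk).le ((metricDist_comm g _ _).trans_le dist_lt.le)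
    _ = ε := ENNReal.add_halves ε

variable {g'}

theorem metricDist_map_le {φ : X → Y} (hφ : ContMDiff I I' 1 φ)
    (hle : ∀ (x : X) (v : TangentSpace I x),
      g'.inner (φ x) (mfderiv I I' φ x v) (mfderiv I I' φ x v) ≤ g.inner x v v) (x y : X) :
    metricDist I' g' (φ x) (φ y) ≤ metricDist I g x y := by
  let _ : Bundle.RiemannianBundle (fun x : X ↦ TangentSpace I x) := ⟨g.toRiemannianMetric⟩
  let _ : Bundle.RiemannianBundle (fun y : Y ↦ TangentSpace I' y) := ⟨g'.toRiemannianMetric⟩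
  refine (riemannianEDist_map_le_mul hφ one_ne_zero (fun x v ↦ ?_) x y).trans_eq (one_mul _)
  rw [enorm_tangentSpace g, enorm_tangentSpace g', ENNReal.coe_one, one_mul]
  exact ENNReal.ofReal_le_ofReal (Real.sqrt_le_sqrt (hle x v))

theorem IsCauchy.map {a : ℕ → X} (ha : IsCauchy g a) {φ : X → Y}
    (hφ : ∀ x y, metricDist I' g' (φ x) (φ y) ≤ metricDist I g x y) :
    IsCauchy g' (fun j ↦ φ (a j)) := fun ε hε ↦
  (ha ε hε).imp fun _ hN j hj k hk ↦ (hφ _ _).trans_lt (hN j hj k hk)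

theorem edist_le_mul_metricDist {F : Type*} [NormedAddCommGroup F] [InnerProductSpace ℝ F]
    {f : X → F} (hf : ContMDiff I 𝓘(ℝ, F) 1 f) {C : ℝ≥0} (hC : C ≠ 0)
    (hle : ∀ (x : X) (v : TangentSpace I x),
      ‖(show F from mfderiv I 𝓘(ℝ, F) f x v)‖ ≤ C * √(g.inner x v v)) (x y : X) :
    edist (f x) (f y) ≤ C * metricDist I g x y := by
  let _ : Bundle.RiemannianBundle (fun x : X ↦ TangentSpace I x) := ⟨g.toRiemannianMetric⟩
  rw [IsRiemannianManifold.out (I := 𝓘(ℝ, F)) (f x) (f y)]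
  refine riemannianEDist_map_le_mul hf hC (fun x v ↦ ?_) x y
  calc ‖mfderiv I 𝓘(ℝ, F) f x v‖ₑ
      = ENNReal.ofReal ‖(show F from mfderiv I 𝓘(ℝ, F) f x v)‖ :=
        enorm_tangentSpace_vectorSpace.trans (ofReal_norm _).symm
    _ ≤ ENNReal.ofReal (C * √(g.inner x v v)) := ENNReal.ofReal_le_ofReal (hle x v)
    _ = C * ‖v‖ₑ := by
      rw [ENNReal.ofReal_mul C.coe_nonneg, ENNReal.ofReal_coe_nnreal, enorm_tangentSpace g]

end MetricDist

section Completeness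

open Filter
open scoped NNReal

theorem exists_subseq_tendsto_of_trivializationAt_snd_mem {B F : Type*} [TopologicalSpace B]
    [PseudoMetricSpace F] [ProperSpace F] {V : B → Type*}
    [TopologicalSpace (Bundle.TotalSpace F V)] [∀ b, TopologicalSpace (V b)] [FiberBundle F V]
    {v : ℕ → Bundle.TotalSpace F V} {b : B} (hb : Tendsto (fun j ↦ (v j).proj) atTop (𝓝 b))
    {s : Set F} (hs : Bornology.IsBounded s)
    (hv : ∃ᶠ j in atTop, (trivializationAt F V b (v j)).2 ∈ s) :
    ∃ (v₀ : Bundle.TotalSpace F V) (φ : ℕ → ℕ), StrictMono φ ∧ Tendsto (v ∘ φ) atTop (𝓝 v₀) := by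
  set T := trivializationAt F V b
  have hbT : b ∈ T.baseSet := FiberBundle.mem_baseSet_trivializationAt' b
  obtain ⟨w, -, φ, hφ, hw⟩ := tendsto_subseq_of_frequently_bounded hs hv
  have hbφ : Tendsto (fun j ↦ (v (φ j)).proj) atTop (𝓝 b) := hb.comp hφ.tendsto_atTop
  have symm_continuousAt : ContinuousAt T.toOpenPartialHomeomorph.symm (b, w) :=
    T.toOpenPartialHomeomorph.continuousAt_symm (T.mem_target.2 hbT)
  have symm_tendsto := symm_continuousAt.tendsto.comp (hbφ.prodMk_nhds hw)
  refine ⟨_, φ, hφ, symm_tendsto.congr' ?_⟩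
  filter_upwards [hbφ (T.open_baseSet.mem_nhds hbT)] with j hj
  exact T.symm_apply_mk_proj (T.mem_source.2 hj)

variable {E : Type*} [NormedAddCommGroup E] [NormedSpace ℂ E]
  {M : Type*} [TopologicalSpace M] [ChartedSpace E M]
  {L : M → Type*} [∀ x, AddCommGroup (L x)] [∀ x, Module ℂ (L x)]
  [∀ x, TopologicalSpace (L x)] [TopologicalSpace (Bundle.TotalSpace ℂ L)]
  [FiberBundle ℂ L] [VectorBundle ℂ ℂ L] {h : HermitianMetric E L}

theorem exists_subseq_tendsto_of_dualNormSq_le {a : ℕ → discBundle h} {x : M}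
    (hx : Tendsto (fun j ↦ discProj h (a j)) atTop (𝓝 x)) {c : ℝ} (hc : c < 1)
    (ha : ∀ᶠ j in atTop, h.dualNormSq (a j).1 ≤ c) :
    ∃ (p : discBundle h) (φ : ℕ → ℕ), StrictMono φ ∧ Tendsto (a ∘ φ) atTop (𝓝 p) := by
  have localWeight_lt : ∀ᶠ j in atTop,
      h.localWeight x (discProj h (a j)) < h.localWeight x x + 1 :=
    hx.eventually ((h.contMDiffAt_localWeight x).continuousAt.eventually_lt_const (lt_add_one _))
  have fibre_bounded : ∀ᶠ j in atTop, (dualTrivializationAt L x (a j).1).2 ∈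
      Metric.closedBall (0 : ℂ →L[ℂ] ℂ) √(h.localWeight x x + 1) := by
    filter_upwards [localWeight_lt, hx ((trivializationAt ℂ L x).open_baseSet.mem_nhds
      (FiberBundle.mem_baseSet_trivializationAt' x))] with j weight_lt mem_baseSet
    exact mem_closedBall_zero_iff.2
      (Real.le_sqrt_of_sq_le ((norm_dualTrivializationAt_snd_sq_lt mem_baseSet).trans weight_lt).le)
  have : ProperSpace (ℂ →L[ℂ] ℂ) := FiniteDimensional.proper ℂ _
  obtain ⟨v, φ, hφ, hv⟩ := exists_subseq_tendsto_of_trivializationAt_snd_mem hx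
    Metric.isBounded_closedBall fibre_bounded.frequently
  have dualNormSq_le : h.dualNormSq v ≤ c :=
    le_of_tendsto ((h.continuous_dualNormSq.tendsto v).comp hv) (hφ.tendsto_atTop.eventually ha)
  exact ⟨⟨v, dualNormSq_le.trans_lt hc⟩, φ, hφ, tendsto_subtype_rng.2 hv⟩

theorem dualNormSq_le_of_edist_logDefect_le {p q : discBundle h} {r : ℝ≥0}
    (hpq : edist (logDefect h p) (logDefect h q) ≤ r) :
    h.dualNormSq p.1 ≤ 1 - Real.exp (logDefect h q - r) := by
  have log_le : logDefect h q - r ≤ Real.log (1 - h.dualNormSq p.1) := by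
    have abs_sub_le : |logDefect h q - logDefect h p| ≤ r :=
      (abs_sub_comm _ _).trans_le (edist_le_coe.1 hpq)
    exact sub_le_comm.1 (le_of_abs_le abs_sub_le)
  linarith [(Real.le_log_iff_exp_le (sub_pos.2 p.2)).1 log_le]

variable [IsManifold 𝓘(ℂ, E) ω M] [ContMDiffVectorBundle ω ℂ L 𝓘(ℂ, E)]
  {gM : Bundle.ContMDiffRiemannianMetric 𝓘(ℝ, E) ∞ E (fun x : M ↦ TangentSpace 𝓘(ℝ, E) x)}
  (hM : IsHermitianWithForm 𝓘(ℝ, E) gM h.curvatureForm)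

theorem metricDist_discProj_le (p q : discBundle h) :
    metricDist 𝓘(ℝ, E) gM (discProj h p) (discProj h q) ≤
      metricDist (totalModel E) (discMetric hM) p q :=
  metricDist_map_le ((contMDiff_discProj h).of_le ENat.LEInfty.out)
    (inner_mfderiv_discProj_le_discInner hM) p q

theorem edist_logDefect_le (p q : discBundle h) :
    edist (logDefect h p) (logDefect h q) ≤
      NNReal.sqrt 2 * metricDist (totalModel E) (discMetric hM) p q := by
  refine edist_le_mul_metricDist ((contMDiff_logDefect h).of_le ENat.LEInfty.out)
    (NNReal.sqrt_pos.2 two_pos).ne' (fun p v ↦ ?_) p q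
  refine (Real.abs_le_sqrt (mfderiv_logDefect_sq_le hM p v)).trans_eq ?_
  rw [Real.sqrt_mul zero_le_two, Real.coe_sqrt, NNReal.coe_ofNat]
  rfl

theorem IsCauchy.exists_eventually_dualNormSq_le {a : ℕ → discBundle h}
    (ha : IsCauchy (discMetric hM) a) :
    ∃ c < 1, ∀ᶠ j in atTop, h.dualNormSq (a j).1 ≤ c := by
  obtain ⟨N, hN⟩ := ha 1 one_pos
  refine ⟨1 - Real.exp (logDefect h (a N) - NNReal.sqrt 2), sub_lt_self 1 (Real.exp_pos _), ?_⟩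
  filter_upwards [eventually_ge_atTop N] with j hj
  refine dualNormSq_le_of_edist_logDefect_le ((edist_logDefect_le hM _ _).trans ?_)
  exact (mul_le_mul_right (hN j hj N le_rfl).le _).trans_eq (mul_one _)

theorem isCompleteMetric_discMetric [RegularSpace M]
    (hcomplete : IsCompleteMetric 𝓘(ℝ, E) gM) :
    IsCompleteMetric (totalModel E) (discMetric hM) := by
  intro a ha
  obtain ⟨x, hx⟩ := hcomplete _ (IsCauchy.map ha (metricDist_discProj_le hM))
  obtain ⟨c, hc, dualNormSq_le⟩ := IsCauchy.exists_eventually_dualNormSq_le hM ha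
  obtain ⟨p, φ, hφ, hp⟩ := exists_subseq_tendsto_of_dualNormSq_le
    (tendsto_of_tendsto_metricDist hx) hc dualNormSq_le
  exact ⟨p, IsCauchy.tendsto_metricDist_of_subseq ha hφ hp⟩

end Completeness

end DiscBundle

end

theorem mainTheorem6_general
    {E : Type*} [NormedAddCommGroup E] [NormedSpace ℂ E]
    {M : Type*} [TopologicalSpace M] [RegularSpace M] [ChartedSpace E M]
    [IsManifold 𝓘(ℂ, E) ω M]
    (L : M → Type*) [∀ x, AddCommGroup (L x)] [∀ x, Module ℂ (L x)]
    [∀ x, TopologicalSpace (L x)] [TopologicalSpace (Bundle.TotalSpace ℂ L)]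
    [FiberBundle ℂ L] [VectorBundle ℂ ℂ L] [ContMDiffVectorBundle ω ℂ L 𝓘(ℂ, E)]
    (h : DiscBundle.HermitianMetric E L)
    (gM : Bundle.ContMDiffRiemannianMetric 𝓘(ℝ, E) ∞ E (fun x : M ↦ TangentSpace 𝓘(ℝ, E) x))
    (hM : DiscBundle.IsHermitianWithForm 𝓘(ℝ, E) gM h.curvatureForm)
    (hcomplete : DiscBundle.IsCompleteMetric 𝓘(ℝ, E) gM) :
    ∃ gD : Bundle.ContMDiffRiemannianMetric (DiscBundle.totalModel E) ∞ (E × (ℂ →L[ℂ] ℂ))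
        (fun p : DiscBundle.discBundle h ↦ TangentSpace (DiscBundle.totalModel E) p),
      DiscBundle.IsHermitianWithForm (DiscBundle.totalModel E) gD (DiscBundle.discForm h) ∧
        DiscBundle.IsCompleteMetric (DiscBundle.totalModel E) gD :=
  ⟨DiscBundle.discMetric hM, DiscBundle.isHermitianWithForm_discMetric hM,
    DiscBundle.isCompleteMetric_discMetric hM hcomplete⟩

theorem mainTheorem6
    {E : Type*} [NormedAddCommGroup E] [NormedSpace ℂ E] [FiniteDimensional ℂ E]
    {M : Type*} [TopologicalSpace M] [T2Space M] [ChartedSpace E M] [IsManifold 𝓘(ℂ, E) ω M]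
    (L : M → Type*) [∀ x, AddCommGroup (L x)] [∀ x, Module ℂ (L x)]
    [∀ x, TopologicalSpace (L x)] [TopologicalSpace (Bundle.TotalSpace ℂ L)]
    [FiberBundle ℂ L] [VectorBundle ℂ ℂ L] [ContMDiffVectorBundle ω ℂ L 𝓘(ℂ, E)]
    (h : DiscBundle.HermitianMetric E L)
    (gM : Bundle.ContMDiffRiemannianMetric 𝓘(ℝ, E) ∞ E (fun x : M ↦ TangentSpace 𝓘(ℝ, E) x))
    (hM : DiscBundle.IsHermitianWithForm 𝓘(ℝ, E) gM h.curvatureForm)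
    (hcomplete : DiscBundle.IsCompleteMetric 𝓘(ℝ, E) gM) :
    ∃ gD : Bundle.ContMDiffRiemannianMetric (DiscBundle.totalModel E) ∞ (E × (ℂ →L[ℂ] ℂ))
        (fun p : DiscBundle.discBundle h ↦ TangentSpace (DiscBundle.totalModel E) p),
      DiscBundle.IsHermitianWithForm (DiscBundle.totalModel E) gD (DiscBundle.discForm h) ∧
        DiscBundle.IsCompleteMetric (DiscBundle.totalModel E) gD := by
  have : ProperSpace E := FiniteDimensional.proper ℂ E
  have : LocallyCompactSpace M := ChartedSpace.locallyCompactSpace E M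
  exact mainTheorem6_general L h gM hM hcomplete
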